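/- Consider an ad hoc network in the plane. The transmitters $T_0,T_1,\dots$ form a homogeneous Poisson point process of density $\lambda>0$. The receiver of $T_m$ is at distance $d>0$ from $T_m$; the orientations have a common arbitrary law. The path-loss exponent is $\alpha>2$. The fading coefficients $h_{ms}$ from $T_s$ to the receiver of $T_m$ are i.i.d. Rayleigh (of any scale). Time is slotted, and each transmitter has a battery of infinite capacity. In each slot it receives one unit of energy with probability $p\in(0,1]$ and none otherwise. If $T_m$ uses the access probability $q_m\in[0,1]$ and its battery energy satisfies $E_m(t)\ge 1$, then with probability $q_m$ it transmits in slot $t$, which costs one unit of energy; thus $E_m(t+1)=E_m(t)+A_m(t)-\mathbf 1\{E_m(t)\ge1\}\chi_m(t)$ with $A_m(t)\sim\mathrm{Bernoulli}(p)$ and $\chi_m(t)\sim\mathrm{Bernoulli}(q_m)$. The variables $A_m(t),\chi_m(t)$ and the initial energies $E_m(0)$ are all independent, and the $E_m(0)$ have a common arbitrary law on $\{0,1,2,\dots\}$. Locations, orientations, fading and energy/access variables are independent of each other. Let $d_{ns}$ be the distance from $T_s$ to the receiver of $T_n$ and $$\mathsf{SIR}_n(t)=\frac{d^{-\alpha}|h_{nn}|^2}{\sum_{s\ne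 n}\mathbf 1\{T_s\text{ transmits at }t\}\,d_{ns}^{-\alpha}|h_{ns}|^2}.$$ Fix a threshold $\theta>0$ and a rate $R>0$ (for instance $R=1$ or $R=\log(1+\theta)$). If a typical transmitter $T_n$ uses $q$ and all others use $\tilde q$, its throughput is $$\mathsf{TH}(q,\tilde q)=r\,q\,\mathbb P(\mathsf{SIR}_n>\theta)\,R,\qquad r=\mathbb P(E_n\ge1),$$ where both probabilities are the limits as $t\to\infty$ of the probabilities at time $t$ for a typical transmitter; that is, the expected number of transmitters $T_n$ in a Borel window $A$ of positive finite area that have the property when they use $q$ and all others use $\tilde q$, divided by the expected number of transmitters in $A$. A $q^*\in[0,1]$ is a symmetric Nash equilibrium (SNE) if $\mathsf{TH}(q^*,q^*)=\max_{q\in[0,1]}\mathsf{TH}(q,q^*)$, and the transmission capacity is then $C=\lambda\,\mathsf{TH}(q^*,q^*)$. Put $$\lambda_{max}=\frac1{d^2\theta^{2/\alpha}\kappa(\alpha)},\qquad \kappa(\alpha)=\frac{2\pi^2}{\alpha\sin(2\pi/\alpha)}.$$ Then, for every window $A$, the limits defining $\mathsf{TH}(q,\tilde q)$ exist for all $q,\tilde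 q\in[0,1]$; every $q^*$ with $p\le q^*\le1$ is an SNE; and at any SNE $q^*$ $$\mathsf{TH}(q^*,q^*)=p\,\exp\left(-\frac{p\lambda}{\lambda_{max}}\right)R,\qquad C=\lambda p\,\exp\left(-\frac{p\lambda}{\lambda_{max}}\right)R.$$ In particular, for $R=1$ these are $p\exp(-p\lambda/\lambda_{max})$ and $\lambda p\exp(-p\lambda/\lambda_{max})$. -/

import Mathlib

open MeasureTheory ProbabilityTheory Filter Topology
open scoped ENNReal NNReal

/-- The plane with its Euclidean distance and Lebesgue measure. -/
abbrev Plane : Type := EuclideanSpace ℝ (Fin 2)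

/-- The number of indices `m` with `X m ω ∈ B`, i.e. the number of points in `B`. -/
noncomputable def pointCount {Ω : Type*} (X : ℕ → Ω → Plane) (B : Set Plane) (ω : Ω) : ℕ∞ :=
  {m : ℕ | X m ω ∈ B}.encard

/-- The random points `X 0, X 1, …` enumerate a homogeneous Poisson point process of density `lam`
on the plane: the number of points in a Borel set of finite area is Poisson with mean `lam` times
the area, and the numbers of points in disjoint such sets are independent. -/
structure IsPoissonPointProcess {Ω : Type*} [MeasurableSpace Ω] (P : Measure Ω) (lam : ℝ)
    (X : ℕ → Ω → Plane) : Prop where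
  measurable : ∀ m, Measurable (X m)
  count_law : ∀ B : Set Plane, MeasurableSet B → volume B < ∞ → ∀ k : ℕ,
    P {ω | pointCount X B ω = k} = poissonMeasure (Real.toNNReal (lam * (volume B).toReal)) {k}
  count_indep : ∀ (k : ℕ) (B : Fin k → Set Plane), (∀ i, MeasurableSet (B i)) →
    (∀ i, volume (B i) < ∞) → Pairwise (fun i j => Disjoint (B i) (B j)) →
    iIndepFun (fun i => pointCount X (B i)) P

/-- The Rayleigh distribution with scale `σ`. -/
noncomputable def rayleighMeasure (σ : ℝ) : Measure ℝ :=
  volume.withDensity fun x =>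
    ENNReal.ofReal (if 0 ≤ x then x / σ ^ 2 * Real.exp (-x ^ 2 / (2 * σ ^ 2)) else 0)

/-- The σ-algebra generated by a family of random variables. -/
abbrev generated {Ω ι E : Type*} [mE : MeasurableSpace E] (X : ι → Ω → E) : MeasurableSpace Ω :=
  ⨆ i, mE.comap (X i)

/-- The randomness of an energy harvesting ad hoc network with transmitter density `lam`, energy
arrival rate `p` and Rayleigh fading of scale `σ`. -/
structure HarvestingNetwork {Ω : Type*} [MeasurableSpace Ω] (P : Measure Ω) (lam p σ : ℝ) where
  /-- Location of the transmitter `m`. -/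
  loc : ℕ → Ω → Plane
  /-- Unit vector pointing from the transmitter `m` to its receiver. -/
  dir : ℕ → Ω → Metric.sphere (0 : Plane) 1
  /-- `fade m s` is the fading coefficient from the transmitter `s` to the receiver `m`. -/
  fade : ℕ → ℕ → Ω → ℂ
  /-- Energy in the battery of the transmitter `m` at time `0`. -/
  init : ℕ → Ω → ℕ
  /-- `arrival m t` is the energy that arrives at the transmitter `m` in the slot `t`. -/
  arrival : ℕ → ℕ → Ω → ℕ
  /-- `coin m t` is uniform on `[0, 1]`; with access probability `q` the transmitter `m`, if it has
  energy, transmits in the slot `t` when `coin m t < q`, an event of probability `q`. -/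
  coin : ℕ → ℕ → Ω → ℝ
  loc_poisson : IsPoissonPointProcess P lam loc
  dir_measurable : ∀ m, Measurable (dir m)
  /-- The orientations have one and the same law, which is arbitrary. -/
  dir_law : ∀ m, IdentDistrib (dir m) (dir 0) P P
  fade_measurable : ∀ m s, Measurable (fade m s)
  fade_law : ∀ m s, P.map (fun ω => ‖fade m s ω‖) = rayleighMeasure σ
  fade_indep : iIndepFun (fun i : ℕ × ℕ => fade i.1 i.2) P
  init_measurable : ∀ m, Measurable (init m)
  /-- The initial energies are i.i.d. with an arbitrary law on `ℕ`. -/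
  init_law : ∀ m, IdentDistrib (init m) (init 0) P P
  init_indep : iIndepFun init P
  arrival_measurable : ∀ m t, Measurable (arrival m t)
  arrival_one : ∀ m t, P {ω | arrival m t ω = 1} = ENNReal.ofReal p
  arrival_zero : ∀ m t, P {ω | arrival m t ω = 0} = ENNReal.ofReal (1 - p)
  arrival_indep : iIndepFun (fun i : ℕ × ℕ => arrival i.1 i.2) P
  coin_measurable : ∀ m t, Measurable (coin m t)
  coin_law : ∀ m t, P.map (coin m t) = volume.restrict (Set.Icc (0 : ℝ) 1)
  coin_indep : iIndepFun (fun i : ℕ × ℕ => coin i.1 i.2) P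
  /-- Locations, orientations, fading, initial energies, arrivals and coins are independent. -/
  indep : iIndep
    (![generated loc, generated dir, generated (fun i : ℕ × ℕ => fade i.1 i.2), generated init,
      generated (fun i : ℕ × ℕ => arrival i.1 i.2), generated (fun i : ℕ × ℕ => coin i.1 i.2)]
      : Fin 6 → MeasurableSpace Ω) P

namespace HarvestingNetwork

variable {Ω : Type*} [MeasurableSpace Ω] {P : Measure Ω} {lam p σ : ℝ}

/-- Energy of the transmitter `m` at time `t` when it uses the access probability `q` and a battery
of infinite capacity: `E (t + 1) = E t + A t - 1{E t ≥ 1} χ t`. -/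
noncomputable def energy (N : HarvestingNetwork P lam p σ) (q : ℝ) (m : ℕ) : ℕ → Ω → ℕ
  | 0, ω => N.init m ω
  | t + 1, ω => N.energy q m t ω + N.arrival m t ω -
      (if 1 ≤ N.energy q m t ω ∧ N.coin m t ω < q then 1 else 0)

/-- The transmitter `m`, using the access probability `q`, transmits at time `t`. -/
def Transmits (N : HarvestingNetwork P lam p σ) (q : ℝ) (m t : ℕ) (ω : Ω) : Prop :=
  1 ≤ N.energy q m t ω ∧ N.coin m t ω < q

/-- Location of the receiver of the transmitter `n`, at distance `d` from it. -/
noncomputable def receiver (N : HarvestingNetwork P lam p σ) (d : ℝ) (n : ℕ) (ω : Ω) : Plane :=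
  N.loc n ω + d • (N.dir n ω : Plane)

open Classical in
/-- Interference power at the receiver `n` at time `t`, if each transmitter `s` uses the access
probability `prof s` and `α` is the path-loss exponent. -/
noncomputable def interference (N : HarvestingNetwork P lam p σ) (d α : ℝ) (prof : ℕ → ℝ)
    (n t : ℕ) (ω : Ω) : ℝ≥0∞ :=
  ∑' s : ℕ, if s ≠ n ∧ N.Transmits (prof s) s t ω then
    edist (N.loc s ω) (N.receiver d n ω) ^ (-α) * ‖N.fade n s ω‖ₑ ^ 2 else 0

/-- Signal-to-interference ratio between the transmitter `n` and its receiver at time `t`; it is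
infinite when there is no interference. -/
noncomputable def sir (N : HarvestingNetwork P lam p σ) (d α : ℝ) (prof : ℕ → ℝ)
    (n t : ℕ) (ω : Ω) : ℝ≥0∞ :=
  ENNReal.ofReal (d ^ (-α)) * ‖N.fade n n ω‖ₑ ^ 2 / N.interference d α prof n t ω

/-- Probability that the typical transmitter in the window `A` has a property (Palm probability):
the expected number of the transmitters in `A` that have it, divided by the expected number of
transmitters in `A`. `S n` is the event that the transmitter `n` has the property. -/
noncomputable def typicalProb (N : HarvestingNetwork P lam p σ) (A : Set Plane)
    (S : ℕ → Set Ω) : ℝ :=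
  ((∑' n : ℕ, P ({ω | N.loc n ω ∈ A} ∩ S n)) / ∑' n : ℕ, P {ω | N.loc n ω ∈ A}).toReal

/-- Probability that a typical transmitter with access probability `q` has energy at time `t`. -/
noncomputable def energyProbAt (N : HarvestingNetwork P lam p σ) (A : Set Plane) (q : ℝ)
    (t : ℕ) : ℝ :=
  N.typicalProb A fun n => {ω | 1 ≤ N.energy q n t ω}

/-- Probability that `SIR > θ` at time `t` for a typical transmitter that uses the access
probability `q` while all the others use `q'`. -/
noncomputable def successProbAt (N : HarvestingNetwork P lam p σ) (A : Set Plane)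
    (d α θ q q' : ℝ) (t : ℕ) : ℝ :=
  N.typicalProb A fun n =>
    {ω | ENNReal.ofReal θ < N.sir d α (Function.update (fun _ => q') n q) n t ω}

/-- Steady-state probability of having energy. -/
noncomputable def energyProb (N : HarvestingNetwork P lam p σ) (A : Set Plane) (q : ℝ) : ℝ :=
  limUnder atTop (N.energyProbAt A q)

/-- Steady-state success probability. -/
noncomputable def successProb (N : HarvestingNetwork P lam p σ) (A : Set Plane)
    (d α θ q q' : ℝ) : ℝ :=
  limUnder atTop (N.successProbAt A d α θ q q')

/-- Throughput of a typical transmitter that uses the access probability `q` while all the others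
use `q'`; `R` is the rate of a successful transmission. -/
noncomputable def throughput (N : HarvestingNetwork P lam p σ) (A : Set Plane)
    (d α θ R q q' : ℝ) : ℝ :=
  N.energyProb A q * q * N.successProb A d α θ q q' * R

/-- `qs` is a symmetric Nash equilibrium: if all the others use `qs`, no access probability in
`[0, 1]` gives a transmitter a larger throughput than `qs`. -/
def IsSNE (N : HarvestingNetwork P lam p σ) (A : Set Plane) (d α θ R qs : ℝ) : Prop :=
  qs ∈ Set.Icc (0 : ℝ) 1 ∧
    ∀ q ∈ Set.Icc (0 : ℝ) 1, N.throughput A d α θ R q qs ≤ N.throughput A d α θ R qs qs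

/-- Transmission capacity, the throughput of all nodes per unit area, if all use `qs`. -/
noncomputable def capacity (N : HarvestingNetwork P lam p σ) (A : Set Plane)
    (d α θ R qs : ℝ) : ℝ :=
  lam * N.throughput A d α θ R qs qs

end HarvestingNetwork

/-- `κ(α) = 2π² / (α sin (2π/α))`. -/
noncomputable def pathLossConst (α : ℝ) : ℝ :=
  2 * Real.pi ^ 2 / (α * Real.sin (2 * Real.pi / α))

/-- `λ_max = 1 / (d² θ^(2/α) κ(α))`. -/
noncomputable def lamMax (d α θ : ℝ) : ℝ :=
  1 / (d ^ 2 * θ ^ (2 / α) * pathLossConst α)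

/-!
The law of a battery that starts empty increases stochastically with time, and an initial energy `e`
pays for at most `e` additional transmissions; so the probability of holding at least `k` units of
energy has a limit `g k` that does not depend on the initial law. The balance equations of the
battery telescope to `p - q * g 1 = (p - q) * ⨅ k, g k`, and conservation of energy gives
`q * g 1 ≤ p`. Together they force `q * g 1 = min q p`: in the long run a transmitter that uses `q`
transmits with probability `min q p`.

By Mecke's formula the typical transmitter sees a Poisson process of interferers. The power of a
Rayleigh fading coefficient is exponential, so, given all the other variables, the event
`θ < SIR` has the probability `exp (-s * I)` with `I` the interference and `s` a constant, and the
Laplace functional of the Poisson process turns its mean into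
`exp (-(min q' p * lam / lamMax d α θ))`. The throughput is thus
`min q p * exp (-(min q' p * lam / lamMax d α θ)) * R`, which is largest for every `q ≥ p`.
-/

/-! ### The battery chain -/

/-- Transition operator of the battery with arrival probability `p` and access probability `q`:
`batteryStep p q f e` is the mean of `f` over the energy one slot after it was `e`. -/
noncomputable def batteryStep (p q : ℝ) : (ℕ → ℝ) →ₗ[ℝ] ℕ → ℝ where
  toFun f
    | 0 => (1 - p) * f 0 + p * f 1
    | e + 1 => (1 - p) * q * f e + ((1 - p) * (1 - q) + p * q) * f (e + 1) +
        p * (1 - q) * f (e + 2)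
  map_add' f g := by
    funext e
    cases e <;> simp only [Pi.add_apply] <;> ring
  map_smul' c f := by
    funext e
    cases e <;> simp only [Pi.smul_apply, smul_eq_mul, RingHom.id_apply] <;> ring

namespace batteryStep

open Set

variable {p q : ℝ} {f g : ℕ → ℝ}

@[simp] lemma apply_zero : batteryStep p q f 0 = (1 - p) * f 0 + p * f 1 := rfl

@[simp] lemma apply_succ (e : ℕ) : batteryStep p q f (e + 1) =
    (1 - p) * q * f e + ((1 - p) * (1 - q) + p * q) * f (e + 1) + p * (1 - q) * f (e + 2) := rfl

lemma apply_le_apply (hp : p ∈ Icc 0 1) (hq : q ∈ Icc 0 1) (h : f ≤ g) :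
    batteryStep p q f ≤ batteryStep p q g := by
  have hp' : 0 ≤ 1 - p := sub_nonneg.2 hp.2
  have hq' : 0 ≤ 1 - q := sub_nonneg.2 hq.2
  obtain ⟨hp, -⟩ := hp
  obtain ⟨hq, -⟩ := hq
  rintro (_ | e)
  · simp only [apply_zero]
    gcongr <;> apply h
  · simp only [apply_succ]
    gcongr <;> apply h

lemma monotone_apply (hp : p ∈ Icc 0 1) (hq : q ∈ Icc 0 1) (h : Monotone f) :
    Monotone (batteryStep p q f) := by
  have hp' : 0 ≤ 1 - p := sub_nonneg.2 hp.2
  have hq' : 0 ≤ 1 - q := sub_nonneg.2 hq.2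
  obtain ⟨hp, -⟩ := hp
  obtain ⟨hq, -⟩ := hq
  refine monotone_nat_of_le_succ fun e => ?_
  have h1 : f (e + 1) ≤ f (e + 2) := h (by lia)
  have h0 : f e ≤ f (e + 1) := h (by lia)
  rcases e with _ | e
  · simp only [apply_zero, apply_succ, zero_add] at h0 h1 ⊢
    nlinarith [mul_nonneg (mul_nonneg hp' hq') (sub_nonneg.2 h0),
      mul_nonneg (mul_nonneg hp hq') (sub_nonneg.2 h1)]
  · simp only [apply_succ]
    have h2 : f e ≤ f (e + 1) := h (by lia)
    gcongr

lemma pow_apply_le_pow_apply (hp : p ∈ Icc 0 1) (hq : q ∈ Icc 0 1) (h : f ≤ g) (t : ℕ) :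
    (batteryStep p q ^ t) f ≤ (batteryStep p q ^ t) g := by
  induction t with
  | zero => exact h
  | succ t ih => simpa only [pow_succ', Module.End.mul_apply] using apply_le_apply hp hq ih

lemma monotone_pow_apply (hp : p ∈ Icc 0 1) (hq : q ∈ Icc 0 1) (h : Monotone f) (t : ℕ) :
    Monotone ((batteryStep p q ^ t) f) := by
  induction t with
  | zero => exact h
  | succ t ih => simpa only [pow_succ', Module.End.mul_apply] using monotone_apply hp hq ih

lemma pow_const (c : ℝ) (t : ℕ) :
    (batteryStep p q ^ t) (Function.const ℕ c) = Function.const ℕ c := by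
  rw [Module.End.pow_apply]
  refine Function.iterate_fixed ?_ t
  funext e
  cases e <;> simp only [apply_zero, apply_succ, Function.const_apply] <;> ring

lemma pow_apply_nonneg (hp : p ∈ Icc 0 1) (hq : q ∈ Icc 0 1) (h : ∀ e, 0 ≤ f e) (t e : ℕ) :
    0 ≤ (batteryStep p q ^ t) f e := by
  simpa only [pow_const] using! pow_apply_le_pow_apply hp hq (f := Function.const ℕ 0) h t e

lemma pow_apply_le_one (hp : p ∈ Icc 0 1) (hq : q ∈ Icc 0 1) (h : ∀ e, f e ≤ 1) (t e : ℕ) :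
    (batteryStep p q ^ t) f e ≤ 1 := by
  simpa only [pow_const] using! pow_apply_le_pow_apply hp hq (g := Function.const ℕ 1) h t e

lemma monotone_pow_apply_zero (hp : p ∈ Icc 0 1) (hq : q ∈ Icc 0 1) (h : Monotone f) :
    Monotone fun t => (batteryStep p q ^ t) f 0 := by
  refine monotone_nat_of_le_succ fun t => ?_
  have h01 := monotone_pow_apply hp hq h t zero_le_one
  rw [pow_succ', Module.End.mul_apply, apply_zero]
  nlinarith [hp.1]

lemma monotone_indicator_Ici (k : ℕ) : Monotone ((Ici k).indicator (1 : ℕ → ℝ)) := fun a b h => by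
  by_cases ha : k ≤ a
  · simp [ha, ha.trans h]
  · rw [indicator_of_notMem (by simpa using ha)]
    exact indicator_nonneg (fun _ _ => zero_le_one) b

lemma apply_indicator_Ici_one : batteryStep p q ((Ici 1).indicator 1) = (Ici 1).indicator 1 +
    (p • ((Ici 0).indicator 1 - (Ici 1).indicator 1) -
      (q * (1 - p)) • ((Ici 1).indicator 1 - (Ici 2).indicator 1)) := by
  funext e
  rcases e with _ | _ | e <;> simp [indicator] <;> ring

lemma apply_indicator_Ici_add_two (k : ℕ) :
    batteryStep p q ((Ici (k + 2)).indicator 1) = (Ici (k + 2)).indicator 1 +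
      ((p * (1 - q)) • ((Ici (k + 1)).indicator 1 - (Ici (k + 2)).indicator 1) -
        (q * (1 - p)) • ((Ici (k + 2)).indicator 1 - (Ici (k + 3)).indicator 1)) := by
  funext e
  rcases e with _ | e
  · simp [indicator]
  · simp only [apply_succ, indicator, mem_Ici, Pi.one_apply, Pi.add_apply, Pi.sub_apply,
      Pi.smul_apply, smul_eq_mul]
    split_ifs <;> first | lia | ring

lemma apply_natCast : batteryStep p q (fun e => (e : ℝ)) =
    (fun e : ℕ => (e : ℝ)) + (Function.const ℕ p - q • (Ici 1).indicator 1) := by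
  funext e
  cases e <;> simp [indicator]
  ring

lemma pow_apply_natCast (t e : ℕ) : (batteryStep p q ^ t) (fun e => (e : ℝ)) e =
    e + ∑ s ∈ Finset.range t, (p - q * (batteryStep p q ^ s) ((Ici 1).indicator 1) e) := by
  induction t with
  | zero => simp
  | succ t ih =>
    rw [pow_succ, Module.End.mul_apply, apply_natCast, map_add, map_sub, map_smul, pow_const,
      Finset.sum_range_succ, ← add_assoc, ← ih]
    rfl

/-- `limitTail p q k` is the limit, as `t → ∞`, of the probability that a battery that is empty at
time `0` has energy at least `k` at time `t`; by monotonicity it is a supremum. -/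
noncomputable def limitTail (p q : ℝ) (k : ℕ) : ℝ :=
  ⨆ t, (batteryStep p q ^ t) ((Ici k).indicator 1) 0

lemma indicator_Ici_le_one (k e : ℕ) : (Ici k).indicator (1 : ℕ → ℝ) e ≤ 1 :=
  indicator_le_self' (fun _ _ => zero_le_one) e

lemma tendsto_limitTail (hp : p ∈ Icc 0 1) (hq : q ∈ Icc 0 1) (k : ℕ) :
    Tendsto (fun t => (batteryStep p q ^ t) ((Ici k).indicator 1) 0) atTop
      (𝓝 (limitTail p q k)) :=
  tendsto_atTop_ciSup (monotone_pow_apply_zero hp hq (monotone_indicator_Ici k))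
    ⟨1, by rintro _ ⟨t, rfl⟩; exact pow_apply_le_one hp hq (indicator_Ici_le_one k) t 0⟩

lemma limitTail_zero : limitTail p q 0 = 1 := by
  have h : (Ici 0).indicator 1 = Function.const ℕ (1 : ℝ) := by funext e; simp
  simp only [limitTail, h, pow_const, Function.const_apply, ciSup_const]

lemma limitTail_nonneg (hp : p ∈ Icc 0 1) (hq : q ∈ Icc 0 1) (k : ℕ) : 0 ≤ limitTail p q k :=
  ge_of_tendsto' (tendsto_limitTail hp hq k) fun t =>
    pow_apply_nonneg hp hq (indicator_nonneg fun _ _ => zero_le_one) t 0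

lemma antitone_limitTail (hp : p ∈ Icc 0 1) (hq : q ∈ Icc 0 1) : Antitone (limitTail p q) :=
  fun k l h => le_of_tendsto_of_tendsto' (tendsto_limitTail hp hq l) (tendsto_limitTail hp hq k)
    fun t => pow_apply_le_pow_apply hp hq
      (indicator_le_indicator_of_subset (Ici_subset_Ici.2 h) fun _ => zero_le_one) t 0

lemma limitTail_one_balance (hp : p ∈ Icc 0 1) (hq : q ∈ Icc 0 1) :
    p * (limitTail p q 0 - limitTail p q 1) =
      q * (1 - p) * (limitTail p q 1 - limitTail p q 2) := by
  have ht := tendsto_limitTail hp hq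
  have h := (ht 1).add ((((ht 0).sub (ht 1)).const_mul p).sub
    (((ht 1).sub (ht 2)).const_mul (q * (1 - p))))
  have := tendsto_nhds_unique ((ht 1).comp (tendsto_add_atTop_nat 1)) (h.congr fun t => by
    simp only [Function.comp_apply, pow_succ, Module.End.mul_apply, apply_indicator_Ici_one,
      map_add, map_sub, map_smul, Pi.add_apply, Pi.sub_apply, Pi.smul_apply, smul_eq_mul])
  linarith

lemma limitTail_add_two_balance (hp : p ∈ Icc 0 1) (hq : q ∈ Icc 0 1) (k : ℕ) :
    p * (1 - q) * (limitTail p q (k + 1) - limitTail p q (k + 2)) =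
      q * (1 - p) * (limitTail p q (k + 2) - limitTail p q (k + 3)) := by
  have ht := tendsto_limitTail hp hq
  have h := (ht (k + 2)).add ((((ht (k + 1)).sub (ht (k + 2))).const_mul (p * (1 - q))).sub
    (((ht (k + 2)).sub (ht (k + 3))).const_mul (q * (1 - p))))
  have := tendsto_nhds_unique ((ht (k + 2)).comp (tendsto_add_atTop_nat 1)) (h.congr fun t => by
    simp only [Function.comp_apply, pow_succ, Module.End.mul_apply, apply_indicator_Ici_add_two,
      map_add, map_sub, map_smul, Pi.add_apply, Pi.sub_apply, Pi.smul_apply, smul_eq_mul])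
  linarith

lemma sub_mul_limitTail_one (hp : p ∈ Icc 0 1) (hq : q ∈ Icc 0 1) :
    p - q * limitTail p q 1 = (p - q) * ⨅ k, limitTail p q k := by
  have hsum (n : ℕ) : p - q * limitTail p q 1 =
      p * (1 - q) * limitTail p q (n + 1) - q * (1 - p) * limitTail p q (n + 2) := by
    induction n with
    | zero =>
      have := limitTail_one_balance hp hq
      rw [limitTail_zero] at this
      simp only [zero_add]
      linarith
    | succ n ih => linarith [limitTail_add_two_balance hp hq n]
  have hG := tendsto_atTop_ciInf (antitone_limitTail hp hq)
    ⟨0, by rintro _ ⟨k, rfl⟩; exact limitTail_nonneg hp hq k⟩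
  have := tendsto_nhds_unique (tendsto_const_nhds.congr hsum)
    (((hG.comp (tendsto_add_atTop_nat 1)).const_mul (p * (1 - q))).sub
      ((hG.comp (tendsto_add_atTop_nat 2)).const_mul (q * (1 - p))))
  linarith

/-- The mean energy cannot become negative, so energy is spent at most as fast as it arrives. -/
lemma mul_limitTail_one_le (hp : p ∈ Icc 0 1) (hq : q ∈ Icc 0 1) : q * limitTail p q 1 ≤ p := by
  refine sub_nonneg.1 (ge_of_tendsto'
    (((tendsto_limitTail hp hq 1).const_mul q).const_sub p).cesaro fun n => ?_)
  have := pow_apply_natCast (p := p) (q := q) n 0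
  rw [Nat.cast_zero, zero_add] at this
  rw [← this]
  exact mul_nonneg (by positivity) (pow_apply_nonneg hp hq (fun e => e.cast_nonneg) n 0)

lemma limitTail_one (hp : p ∈ Icc 0 1) (hp0 : 0 < p) (hq : q ∈ Icc 0 1) :
    limitTail p q 1 = if q ≤ p then 1 else p / q := by
  have hid := sub_mul_limitTail_one hp hq
  have hG0 : 0 ≤ ⨅ k, limitTail p q k := le_ciInf (limitTail_nonneg hp hq)
  have hG1 : ⨅ k, limitTail p q k ≤ limitTail p q 1 :=
    ciInf_le ⟨0, by rintro _ ⟨k, rfl⟩; exact limitTail_nonneg hp hq k⟩ 1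
  split_ifs with hqp
  · have h1 := antitone_limitTail hp hq zero_le_one
    rw [limitTail_zero] at h1
    refine h1.antisymm (le_of_mul_le_mul_left ?_ hp0)
    nlinarith [mul_le_mul_of_nonneg_left hG1 (sub_nonneg.2 hqp)]
  · rw [eq_div_iff (by linarith), mul_comm]
    refine (mul_limitTail_one_le hp hq).antisymm ?_
    nlinarith [mul_nonneg (sub_nonneg.2 (not_le.1 hqp).le) hG0]

/-- An initial energy `e` pays for at most `e` additional transmissions. -/
lemma summable_pow_apply_sub_pow_apply_zero (hp : p ∈ Icc 0 1) (hq : q ∈ Icc 0 1) (hq0 : 0 < q)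
    (e : ℕ) : Summable fun t => (batteryStep p q ^ t) ((Ici 1).indicator 1) e -
      (batteryStep p q ^ t) ((Ici 1).indicator 1) 0 := by
  refine summable_of_sum_range_le (c := e / q) (fun t => sub_nonneg.2
    (monotone_pow_apply hp hq (monotone_indicator_Ici 1) t e.zero_le)) fun n => ?_
  have hmono := monotone_pow_apply hp hq Nat.mono_cast n e.zero_le
  rw [pow_apply_natCast, pow_apply_natCast] at hmono
  rw [le_div_iff₀ hq0]
  simp only [Finset.sum_sub_distrib, ← Finset.mul_sum, Nat.cast_zero] at hmono ⊢
  linarith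

lemma tendsto_pow_apply_indicator_Ici_one (hp : p ∈ Icc 0 1) (hp0 : 0 < p) (hq : q ∈ Icc 0 1)
    (e : ℕ) : Tendsto (fun t => (batteryStep p q ^ t) ((Ici 1).indicator 1) e) atTop
      (𝓝 (if q ≤ p then 1 else p / q)) := by
  have h0 := tendsto_limitTail hp hq 1
  rw [limitTail_one hp hp0 hq] at h0
  split_ifs with hqp
  · rw [if_pos hqp] at h0
    exact tendsto_of_tendsto_of_tendsto_of_le_of_le h0 tendsto_const_nhds
      (fun t => monotone_pow_apply hp hq (monotone_indicator_Ici 1) t e.zero_le)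
      fun t => pow_apply_le_one hp hq (indicator_Ici_le_one 1) t e
  · rw [if_neg hqp] at h0
    have hq0 : 0 < q := hp0.trans (not_le.1 hqp)
    simpa using (summable_pow_apply_sub_pow_apply_zero hp hq hq0 e).tendsto_atTop_zero.add h0

end batteryStep

/-! ### Laplace transforms of Poisson variables -/

/-- `exp (-x)` for `x` in `[0, ∞]`, with `exp (-∞) = 0`. -/
noncomputable def negExp (x : ℝ≥0∞) : ℝ≥0∞ := EReal.exp (-(x : EReal))

@[simp] lemma negExp_zero : negExp 0 = 1 := by
  simp [negExp]

@[simp] lemma negExp_top : negExp ∞ = 0 := by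
  simp [negExp]

lemma negExp_add (x y : ℝ≥0∞) : negExp (x + y) = negExp x * negExp y := by
  simp only [negExp, EReal.coe_ennreal_add, ← EReal.exp_add]
  rw [EReal.neg_add (Or.inl (by simp)) (Or.inr (by simp)), sub_eq_add_neg]

lemma negExp_le_one (x : ℝ≥0∞) : negExp x ≤ 1 := by
  simp [negExp, EReal.coe_ennreal_nonneg]

lemma negExp_ne_top (x : ℝ≥0∞) : negExp x ≠ ∞ :=
  ((negExp_le_one x).trans_lt ENNReal.one_lt_top).ne

lemma antitone_negExp : Antitone negExp := fun x y h => by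
  simpa [negExp] using h

lemma continuous_negExp : Continuous negExp :=
  ENNReal.continuous_exp.comp (continuous_neg.comp continuous_coe_ennreal_ereal)

lemma measurable_negExp : Measurable negExp := continuous_negExp.measurable

lemma negExp_ofReal {x : ℝ} (hx : 0 ≤ x) :
    negExp (ENNReal.ofReal x) = ENNReal.ofReal (Real.exp (-x)) := by
  rw [negExp, EReal.coe_ennreal_ofReal, max_eq_left hx, ← EReal.coe_neg, EReal.exp_coe]

lemma negExp_sum {ι : Type*} (s : Finset ι) (f : ι → ℝ≥0∞) :
    negExp (∑ i ∈ s, f i) = ∏ i ∈ s, negExp (f i) := by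
  classical
  induction s using Finset.induction_on with
  | empty => simp
  | insert a s ha ih => rw [Finset.sum_insert ha, Finset.prod_insert ha, negExp_add, ih]

lemma negExp_mul_natCast (x : ℝ≥0∞) (k : ℕ) : negExp (x * k) = negExp x ^ k := by
  simpa [mul_comm x] using negExp_sum (Finset.range k) fun _ => x

lemma tendsto_prod_negExp (f : ℕ → ℝ≥0∞) :
    Tendsto (fun n => ∏ i ∈ Finset.range n, negExp (f i)) atTop (𝓝 (negExp (∑' i, f i))) := by
  simp_rw [← negExp_sum]
  exact (continuous_negExp.tendsto _).comp ENNReal.summable.hasSum.tendsto_sum_nat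

/-- `-log x` for `x` in `[0, 1]`, with `-log 0 = ∞`; the value is `0` for `x ≥ 1`. -/
noncomputable def negLog (x : ℝ≥0∞) : ℝ≥0∞ := (-ENNReal.log x).toENNReal

lemma measurable_negLog : Measurable negLog :=
  (continuous_neg.comp ENNReal.continuous_log).ereal_toENNReal.measurable

lemma negExp_negLog {x : ℝ≥0∞} (hx : x ≤ 1) : negExp (negLog x) = x := by
  rw [negExp, negLog, EReal.coe_toENNReal (by simpa using hx), neg_neg, ENNReal.exp_log]

lemma negLog_one : negLog 1 = 0 := by simp [negLog]

lemma lintegral_pow_poissonMeasure (m : ℝ≥0) {u : ℝ≥0∞} (hu : u ≤ 1) :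
    ∫⁻ k, u ^ k ∂poissonMeasure m = negExp (m * (1 - u)) := by
  lift u to ℝ≥0 using (hu.trans_lt ENNReal.one_lt_top).ne
  have hu' : (u : ℝ) ≤ 1 := by exact_mod_cast hu
  have h := (hasSum_one_poissonMeasure (u * m)).mul_left (Real.exp (-(m * (1 - u))))
  have hterm (k : ℕ) : (u : ℝ≥0∞) ^ k * poissonMeasure m {k} = ENNReal.ofReal
      (Real.exp (-(m * (1 - u))) *
        (Real.exp (-(u * m : ℝ≥0)) * (u * m : ℝ≥0) ^ k / k.factorial)) := by
    have hexp : Real.exp (-(m : ℝ)) = Real.exp (-(m * (1 - u))) * Real.exp (-(u * m : ℝ≥0)) := by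
      rw [← Real.exp_add]
      push_cast
      ring_nf
    rw [poissonMeasure_singleton, ← ENNReal.ofReal_coe_nnreal, ← ENNReal.ofReal_pow u.coe_nonneg,
      ← ENNReal.ofReal_mul (by positivity), hexp]
    push_cast
    ring_nf
  rw [lintegral_countable']
  simp_rw [hterm]
  rw [← ENNReal.ofReal_tsum_of_nonneg (fun k => by positivity) h.summable, h.tsum_eq, mul_one,
    ← negExp_ofReal (mul_nonneg m.coe_nonneg (sub_nonneg.2 hu')),
    ENNReal.ofReal_mul m.coe_nonneg, ENNReal.ofReal_sub _ u.coe_nonneg]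
  simp

lemma succ_mul_poissonMeasure_singleton_succ (m : ℝ≥0) (k : ℕ) :
    ((k + 1 : ℕ) : ℝ≥0∞) * poissonMeasure m {k + 1} = m * poissonMeasure m {k} := by
  rw [poissonMeasure_singleton, poissonMeasure_singleton, ← ENNReal.ofReal_coe_nnreal,
    ← ENNReal.ofReal_natCast, ← ENNReal.ofReal_mul (by positivity),
    ← ENNReal.ofReal_mul (by positivity), Nat.factorial_succ]
  congr 1
  push_cast
  field_simp
  ring

lemma succ_mul_pi_poissonMeasure_singleton_add_single {J : Type*} [Fintype J] [DecidableEq J]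
    (m : J → ℝ≥0) (k : J → ℕ) (i : J) :
    ((k i + 1 : ℕ) : ℝ≥0∞) * Measure.pi (fun j => poissonMeasure (m j)) {k + Pi.single i 1} =
      m i * Measure.pi (fun j => poissonMeasure (m j)) {k} := by
  simp only [Measure.pi_singleton, ← Finset.mul_prod_erase _ _ (Finset.mem_univ i), ← mul_assoc,
    Pi.add_apply, Pi.single_eq_same, succ_mul_poissonMeasure_singleton_succ]
  congr 1
  refine Finset.prod_congr rfl fun j hj => ?_
  rw [Pi.single_eq_of_ne (Finset.ne_of_mem_erase hj), add_zero]

/-- Mecke's formula for the counts in disjoint cells: weighting by the `i`-th count and removing one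
of its points leaves the law unchanged. -/
lemma lintegral_mul_comp_sub_single_pi_poissonMeasure {J : Type*} [Fintype J] [DecidableEq J]
    (m : J → ℝ≥0) (i : J) (F : (J → ℕ) → ℝ≥0∞) :
    ∫⁻ k, k i * F (k - Pi.single i 1) ∂Measure.pi (fun j => poissonMeasure (m j)) =
      m i * ∫⁻ k, F k ∂Measure.pi (fun j => poissonMeasure (m j)) := by
  have hinj : Function.Injective fun k : J → ℕ => k + Pi.single i 1 := add_left_injective _
  rw [lintegral_countable', lintegral_countable', ← ENNReal.tsum_mul_left,
    ← hinj.tsum_eq fun k hk => ?_]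
  · refine tsum_congr fun k => ?_
    rw [mul_right_comm, add_tsub_cancel_right, Pi.add_apply, Pi.single_eq_same,
      succ_mul_pi_poissonMeasure_singleton_add_single]
    ring
  · have hki : k i ≠ 0 := fun h => hk (by simp [h])
    refine ⟨k - Pi.single i 1, tsub_add_cancel_of_le fun j => ?_⟩
    rcases eq_or_ne j i with rfl | hj
    · simpa using Nat.one_le_iff_ne_zero.2 hki
    · simp [hj]

/-! ### Point processes -/

section kernel

variable {E Y : Type*} [MeasurableSpace E] [MeasurableSpace Y]

/-- Integration over `S` as a kernel from measures, cut off where the mass of `S` exceeds `j` in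
order that the kernel be finite. -/
noncomputable def truncatedRestrictKernel {S : Set E} (hS : MeasurableSet S) (j : ℕ) :
    Kernel (Measure E) E :=
  open scoped Classical in
  Kernel.piecewise (s := {μ : Measure E | μ S ≤ j})
    (measurableSet_le (Measure.measurable_coe hS) measurable_const)
    (Kernel.restrict ⟨id, measurable_id⟩ hS) 0

instance isFiniteKernel_truncatedRestrictKernel {S : Set E} (hS : MeasurableSet S) (j : ℕ) :
    IsFiniteKernel (truncatedRestrictKernel hS j) := by
  refine ⟨j, ENNReal.natCast_lt_top j, fun μ => ?_⟩
  classical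
  rw [truncatedRestrictKernel, Kernel.piecewise_apply]
  split_ifs with hμ
  · simpa [Kernel.restrict_apply] using hμ
  · simp

lemma iSup_lintegral_truncatedRestrictKernel {S : Set E} (hS : MeasurableSet S)
    {μ : Measure E} (hμ : μ S ≠ ∞) (f : E → ℝ≥0∞) :
    ⨆ j, ∫⁻ z, f z ∂truncatedRestrictKernel hS j μ = ∫⁻ z in S, f z ∂μ := by
  classical
  obtain ⟨k, hk⟩ := ENNReal.exists_nat_gt hμ
  simp only [truncatedRestrictKernel, Kernel.lintegral_piecewise, Kernel.restrict_apply]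
  refine le_antisymm (iSup_le fun j => ?_) (le_iSup_of_le k ?_)
  · split_ifs
    exacts [le_rfl, by simp]
  · rw [if_pos (by exact hk.le)]
    rfl

lemma aemeasurable_lintegral_prodMk {ρ : Measure (Y × Measure E)} {S : ℕ → Set E}
    (hS : ∀ k, MeasurableSet (S k)) (hmono : Monotone S) (huniv : ⋃ k, S k = Set.univ)
    (hρ : ∀ k, ∀ᵐ y ∂ρ, y.2 (S k) ≠ ∞) {g : Y → E → ℝ≥0∞}
    (hg : Measurable (Function.uncurry g)) :
    AEMeasurable (fun y : Y × Measure E => ∫⁻ z, g y.1 z ∂y.2) ρ := by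
  refine ⟨fun y => ⨆ k, ⨆ j, ∫⁻ z, g y.1 z ∂truncatedRestrictKernel (hS k) j y.2,
    .iSup fun k => .iSup fun j => ?_, ?_⟩
  · exact Measurable.lintegral_kernel_prod_right'
      (κ := (truncatedRestrictKernel (hS k) j).comap Prod.snd measurable_snd)
      (f := fun y => g y.1.1 y.2) (hg.comp (measurable_fst.fst.prodMk measurable_snd))
  · filter_upwards [ae_all_iff.2 hρ] with y hy
    simp_rw [iSup_lintegral_truncatedRestrictKernel (hS _) (hy _)]
    rw [← setLIntegral_iUnion_of_directed _ hmono.directed_le, huniv, Measure.restrict_univ]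

end kernel

/-- The counting measure `∑ i, δ_{X i ω}` of the random points `X i`. -/
noncomputable def pointMeasure {Ω E ι : Type*} [MeasurableSpace E] (X : ι → Ω → E) (ω : Ω) :
    Measure E :=
  Measure.sum fun i => Measure.dirac (X i ω)

/-- The counting measure of the random points `X i` other than `X n`. -/
noncomputable def reducedPointMeasure {Ω E ι : Type*} [MeasurableSpace E] (X : ι → Ω → E) (n : ι) :
    Ω → Measure E :=
  pointMeasure fun i : {i // i ≠ n} => X i

section pointMeasure

variable {Ω E ι : Type*} [MeasurableSpace E] {X : ι → Ω → E}

lemma pointMeasure_apply {B : Set E} (hB : MeasurableSet B) (ω : Ω) :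
    pointMeasure X ω B = ∑' i, B.indicator 1 (X i ω) := by
  simp only [pointMeasure, Measure.sum_apply _ hB, Measure.dirac_apply' _ hB]

lemma lintegral_pointMeasure {f : E → ℝ≥0∞} (hf : Measurable f) (ω : Ω) :
    ∫⁻ x, f x ∂pointMeasure X ω = ∑' i, f (X i ω) := by
  simp only [pointMeasure, lintegral_sum_measure, lintegral_dirac' _ hf]

lemma measurable_pointMeasure [MeasurableSpace Ω] [Countable ι] (hX : ∀ i, Measurable (X i)) :
    Measurable (pointMeasure X) := by
  refine Measure.measurable_of_measurable_coe _ fun B hB => ?_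
  simp_rw [pointMeasure_apply hB]
  exact Measurable.tsum fun i => (measurable_one.indicator hB).comp (hX i)

lemma pointMeasure_eq_reducedPointMeasure_add (n : ι) (ω : Ω) :
    pointMeasure X ω = reducedPointMeasure X n ω + Measure.dirac (X n ω) := by
  classical
  ext B hB
  rw [Measure.add_apply, reducedPointMeasure, pointMeasure_apply hB, pointMeasure_apply hB,
    Measure.dirac_apply' _ hB, ENNReal.tsum_eq_add_tsum_ite n, add_comm]
  congr 1
  refine .trans (tsum_congr fun i => ?_)
    (tsum_subtype {i | i ≠ n} fun i => B.indicator (1 : E → ℝ≥0∞) (X i ω)).symm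
  by_cases hi : i = n <;> simp [hi]

lemma toENNReal_pointCount (X : ℕ → Ω → Plane) {B : Set Plane} (hB : MeasurableSet B) (ω : Ω) :
    (pointCount X B ω : ℝ≥0∞) = pointMeasure X ω B := by
  rw [pointCount, ← ENNReal.tsum_set_one, pointMeasure_apply hB]
  exact tsum_subtype {m | X m ω ∈ B} fun _ => (1 : ℝ≥0∞)

lemma tsum_indicator_mul_comp_reducedPointMeasure {J : Type*} [DecidableEq J]
    {C : J → Set E} (hC : ∀ j, MeasurableSet (C j)) (hd : Pairwise fun i j => Disjoint (C i) (C j))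
    (F : (J → ℝ≥0∞) → ℝ≥0∞) (i : J) (ω : Ω) :
    ∑' n, (C i).indicator 1 (X n ω) * F (fun j => reducedPointMeasure X n ω (C j)) =
      pointMeasure X ω (C i) *
        F ((fun j => pointMeasure X ω (C j)) - Pi.single i 1) := by
  rw [pointMeasure_apply (hC i), ← ENNReal.tsum_mul_right]
  refine tsum_congr fun n => ?_
  by_cases hn : X n ω ∈ C i
  · congr 2
    funext j
    simp only [pointMeasure_eq_reducedPointMeasure_add (X := X) n ω, Measure.add_apply,
      Measure.dirac_apply' _ (hC j), Pi.sub_apply]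
    rcases eq_or_ne j i with rfl | hj
    · simp [hn]
    · simp [hj, Set.disjoint_left.1 (hd hj.symm) hn]
  · simp [hn]

end pointMeasure

section memberCell

variable {E ι : Type*} {B : ι → Set E}

/-- The points whose memberships in the sets `B i` are given by `l`: the cells of the partition
generated by the family `B`. -/
def memberCell (B : ι → Set E) (l : ι → Prop) : Set E := {x | ∀ i, x ∈ B i ↔ l i}

lemma memberCell_subset {l : ι → Prop} {i : ι} (hi : l i) : memberCell B l ⊆ B i :=
  fun _ hx => (hx i).2 hi

lemma disjoint_memberCell {l l' : ι → Prop} (h : l ≠ l') :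
    Disjoint (memberCell B l) (memberCell B l') :=
  Set.disjoint_left.2 fun _ hx hx' => h (funext fun i => propext ((hx i).symm.trans (hx' i)))

lemma measurableSet_memberCell [MeasurableSpace E] [Countable ι] (hB : ∀ i, MeasurableSet (B i))
    (l : ι → Prop) : MeasurableSet (memberCell B l) := by
  rw [memberCell, Set.ofPred_forall]
  exact MeasurableSet.iInter fun i => ((hB i).mem.iff measurable_const).setOf

open Classical in
lemma measure_eq_sum_memberCell [MeasurableSpace E] [Finite ι] [Fintype {l : ι → Prop // ∃ i, l i}]
    (hB : ∀ i, MeasurableSet (B i)) (μ : Measure E) (i : ι) :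
    μ (B i) = ∑ l : {l : ι → Prop // ∃ i, l i}, if l.1 i then μ (memberCell B l) else 0 := by
  rw [← Finset.sum_filter, ← measure_biUnion_finset
    (fun l _ l' _ h => disjoint_memberCell fun he => h (Subtype.ext he))
    fun l _ => measurableSet_memberCell hB l]
  congr 1
  ext x
  simp only [Finset.mem_filter_univ, Set.mem_iUnion, exists_prop]
  exact ⟨fun hx => ⟨⟨fun j => x ∈ B j, i, hx⟩, hx, fun j => .rfl⟩,
    fun ⟨l, hl, hx⟩ => memberCell_subset hl hx⟩

open Classical in
lemma indicator_eq_sum_memberCell [MeasurableSpace E] [Finite ι]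
    [Fintype {l : ι → Prop // ∃ i, l i}] (hB : ∀ i, MeasurableSet (B i)) (i : ι) (x : E) :
    (B i).indicator (1 : E → ℝ≥0∞) x =
      ∑ l : {l : ι → Prop // ∃ i, l i}, if l.1 i then (memberCell B l).indicator 1 x else 0 := by
  simpa only [Measure.dirac_apply' x (hB _), Measure.dirac_apply' x (measurableSet_memberCell hB _)]
    using measure_eq_sum_memberCell hB (Measure.dirac x) i

end memberCell

section spanningSets

variable {E : Type*} [MeasurableSpace E] (ν : Measure E) [SigmaFinite ν]

lemma iSup_measure_inter_spanningSets (μ : Measure E) (B : Set E) :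
    ⨆ n, μ (B ∩ spanningSets ν n) = μ B := by
  rw [← Monotone.measure_iUnion fun m n h =>
    Set.inter_subset_inter_right B (monotone_spanningSets ν h), ← Set.inter_iUnion,
    iUnion_spanningSets, Set.inter_univ]

lemma measure_inter_spanningSets_ne_top (B : Set E) (n : ℕ) :
    ν (B ∩ spanningSets ν n) ≠ ∞ :=
  measure_ne_top_of_subset Set.inter_subset_right (measure_spanningSets_lt_top _ n).ne

lemma generateFrom_measurableSet_measure_ne_top :
    MeasurableSpace.generateFrom {A : Set E | MeasurableSet A ∧ ν A ≠ ∞} =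
      ‹MeasurableSpace E› := by
  refine le_antisymm (MeasurableSpace.generateFrom_le fun A hA => hA.1) fun A hA => ?_
  rw [← Set.inter_univ A, ← iUnion_spanningSets ν, Set.inter_iUnion]
  exact MeasurableSet.iUnion fun n => MeasurableSpace.measurableSet_generateFrom
    ⟨MeasurableSet.inter hA (measurableSet_spanningSets _ n),
      measure_inter_spanningSets_ne_top ν A n⟩

lemma tendsto_setLIntegral_spanningSets (μ : Measure E) {f : ℕ → E → ℝ≥0∞}
    {g : E → ℝ≥0∞} (hf : ∀ n, Measurable (f n)) (hmono : Monotone f)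
    (hlim : ∀ z, Tendsto (fun n => f n z) atTop (𝓝 (g z))) :
    Tendsto (fun n => ∫⁻ z in spanningSets ν n, f n z ∂μ) atTop (𝓝 (∫⁻ z, g z ∂μ)) := by
  simp_rw [← lintegral_indicator (measurableSet_spanningSets _ _)]
  refine lintegral_tendsto_of_tendsto_of_monotone
    (fun n => ((hf n).indicator (measurableSet_spanningSets _ n)).aemeasurable)
    (ae_of_all _ fun z m n hmn => ?_) (ae_of_all _ fun z => (hlim z).congr' ?_)
  · exact (Set.indicator_le_indicator (hmono hmn z)).trans
      (Set.indicator_le_indicator_of_subset (monotone_spanningSets ν hmn) (fun _ => zero_le) z)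
  · filter_upwards [eventually_ge_atTop (spanningSetsIndex ν z)] with n hn
    rw [Set.indicator_of_mem (monotone_spanningSets ν hn (mem_spanningSetsIndex ν z))]

end spanningSets

section countEvents

variable {E : Type*} [MeasurableSpace E] {ν : Measure E}

/-- The events that depend on the masses of finitely many measurable sets of finite `ν`-measure. -/
def countEvents (ν : Measure E) : Set (Set (Measure E)) :=
  Set.preimage (fun μ B => μ B.1) ''
    measurableCylinders fun _ : {B : Set E // MeasurableSet B ∧ ν B ≠ ∞} => ℝ≥0∞

lemma isPiSystem_countEvents : IsPiSystem (countEvents ν) :=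
  isPiSystem_measurableCylinders.comap _

lemma generateFrom_countEvents [SigmaFinite ν] :
    MeasurableSpace.generateFrom (countEvents ν) = Measure.instMeasurableSpace := by
  rw [countEvents, ← MeasurableSpace.comap_generateFrom, generateFrom_measurableCylinders]
  refine le_antisymm (measurable_iff_comap_le.1 <| measurable_pi_lambda _ fun B =>
    Measure.measurable_coe B.2.1) (iSup₂_le fun B hB => ?_)
  simp_rw [← iSup_measure_inter_spanningSets ν _ B]
  refine measurable_iff_comap_le.1 <| Measurable.iSup fun n => ?_
  let B' : {B : Set E // MeasurableSet B ∧ ν B ≠ ∞} := ⟨B ∩ spanningSets ν n,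
    hB.inter (measurableSet_spanningSets _ n), measure_inter_spanningSets_ne_top ν B n⟩
  exact (measurable_pi_apply (X := fun _ => ℝ≥0∞) B').comp (comap_measurable _)

lemma measurableSet_of_mem_countEvents [SigmaFinite ν] {D : Set (Measure E)}
    (hD : D ∈ countEvents ν) : MeasurableSet D :=
  generateFrom_countEvents (ν := ν) ▸ MeasurableSpace.measurableSet_generateFrom hD

end countEvents

/-- The intensity measure of a homogeneous point process of density `lam`. -/
noncomputable abbrev intensity (lam : ℝ) : Measure Plane := ENNReal.ofReal lam • volume

lemma intensity_ne_top (lam : ℝ) {B : Set Plane} (hB : volume B ≠ ∞) : intensity lam B ≠ ∞ :=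
  ENNReal.mul_ne_top ENNReal.ofReal_ne_top hB

namespace IsPoissonPointProcess

variable {Ω : Type*} [MeasurableSpace Ω] {P : Measure Ω} {lam : ℝ} {X : ℕ → Ω → Plane}

lemma measurable_pointMeasure_apply (h : IsPoissonPointProcess P lam X) {B : Set Plane}
    (hB : MeasurableSet B) : Measurable fun ω => pointMeasure X ω B :=
  (Measure.measurable_coe hB).comp (measurable_pointMeasure h.measurable)

lemma measure_pointMeasure_eq_natCast (h : IsPoissonPointProcess P lam X) {B : Set Plane}
    (hB : MeasurableSet B) (hB' : volume B ≠ ∞) (k : ℕ) :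
    P {ω | pointMeasure X ω B = k} = poissonMeasure (intensity lam B).toNNReal {k} := by
  have hmean : (intensity lam B).toNNReal = (lam * (volume B).toReal).toNNReal := by
    rw [← ENNReal.coe_inj, ENNReal.coe_toNNReal (intensity_ne_top lam hB')]
    change _ = ENNReal.ofReal _
    rw [ENNReal.ofReal_mul' ENNReal.toReal_nonneg, ENNReal.ofReal_toReal hB']
    rfl
  rw [hmean, ← h.count_law B hB hB'.lt_top k]
  congr 1 with ω
  simp only [Set.mem_ofPred_eq, ← toENNReal_pointCount X hB]
  exact_mod_cast Iff.rfl

lemma map_pointMeasure_apply [IsProbabilityMeasure P] (h : IsPoissonPointProcess P lam X)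
    {B : Set Plane} (hB : MeasurableSet B) (hB' : volume B ≠ ∞) :
    P.map (fun ω => pointMeasure X ω B) =
      (poissonMeasure (intensity lam B).toNNReal).map Nat.cast := by
  have hm := h.measurable_pointMeasure_apply hB
  have := Measure.isProbabilityMeasure_map (μ := P) hm.aemeasurable
  have := Measure.isProbabilityMeasure_map (μ := poissonMeasure (intensity lam B).toNNReal)
    (measurable_from_top (f := (Nat.cast : ℕ → ℝ≥0∞))).aemeasurable
  refine (Measure.eq_of_le_of_measure_univ_eq (Measure.le_iff.2 fun S hS => ?_) (by simp)).symm
  rw [Measure.map_apply measurable_from_top hS, Measure.map_apply hm hS,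
    ← Measure.tsum_indicator_apply_singleton _ _ (measurable_from_top hS), ← tsum_subtype]
  simp_rw [← h.measure_pointMeasure_eq_natCast hB hB']
  rw [← measure_iUnion (f := fun k : (Nat.cast ⁻¹' S : Set ℕ) => {ω | pointMeasure X ω B = (k : ℕ)})
    (fun k l hkl => ?_) fun k => hm (measurableSet_singleton _)]
  · refine measure_mono (Set.iUnion_subset fun k ω hω => ?_)
    rw [Set.mem_preimage, show pointMeasure X ω B = k from hω]
    exact k.2
  · refine Set.disjoint_left.2 fun ω hk hl => hkl (Subtype.ext ?_)
    exact_mod_cast (show _ = _ from hk).symm.trans hl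

lemma ae_pointMeasure_ne_top [IsProbabilityMeasure P] (h : IsPoissonPointProcess P lam X)
    {B : Set Plane} (hB : MeasurableSet B) (hB' : volume B ≠ ∞) :
    ∀ᵐ ω ∂P, pointMeasure X ω B ≠ ∞ := by
  have hne : MeasurableSet {x : ℝ≥0∞ | x ≠ ∞} := (measurableSet_singleton ∞).compl
  rw [← ae_map_iff (h.measurable_pointMeasure_apply hB).aemeasurable hne,
    h.map_pointMeasure_apply hB hB', ae_map_iff measurable_from_top.aemeasurable hne]
  exact ae_of_all _ ENNReal.natCast_ne_top

lemma lintegral_natCast_comp_pointMeasure [IsProbabilityMeasure P]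
    (h : IsPoissonPointProcess P lam X) {B : Set Plane} (hB : MeasurableSet B)
    (hB' : volume B ≠ ∞) {F : ℝ≥0∞ → ℝ≥0∞} (hF : Measurable F) :
    ∫⁻ ω, F (pointMeasure X ω B) ∂P =
      ∫⁻ k : ℕ, F k ∂poissonMeasure (intensity lam B).toNNReal := by
  rw [← lintegral_map hF (h.measurable_pointMeasure_apply hB), h.map_pointMeasure_apply hB hB',
    lintegral_map hF measurable_from_top]

section cells

variable {J : Type*} {C : J → Set Plane}

lemma iIndepFun_pointMeasure [Finite J] (h : IsPoissonPointProcess P lam X)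
    (hC : ∀ j, MeasurableSet (C j)) (hC' : ∀ j, volume (C j) ≠ ∞)
    (hd : Pairwise fun i j => Disjoint (C i) (C j)) :
    iIndepFun (fun j ω => pointMeasure X ω (C j)) P := by
  have e := Finite.equivFin J
  have hi := (h.count_indep (Nat.card J) (C ∘ e.symm) (fun k => hC _)
    (fun k => (hC' _).lt_top) fun i j hij => hd (e.symm.injective.ne hij)).precomp e.injective
  convert! hi.comp (fun _ => ENat.toENNReal) fun _ => measurable_from_top using 2 with j
  funext ω
  simp [toENNReal_pointCount X (hC j)]

lemma map_pointMeasure_pi [Fintype J] [IsProbabilityMeasure P] (h : IsPoissonPointProcess P lam X)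
    (hC : ∀ j, MeasurableSet (C j)) (hC' : ∀ j, volume (C j) ≠ ∞)
    (hd : Pairwise fun i j => Disjoint (C i) (C j)) :
    P.map (fun ω j => pointMeasure X ω (C j)) =
      (Measure.pi fun j => poissonMeasure (intensity lam (C j)).toNNReal).map
        fun k j => (k j : ℝ≥0∞) := by
  rw [(h.iIndepFun_pointMeasure hC hC' hd).map_fun_eq_pi_map
      fun j => (h.measurable_pointMeasure_apply (hC j)).aemeasurable]
  simp_rw [h.map_pointMeasure_apply (hC _) (hC' _)]
  exact (Measure.pi_map_pi fun j => measurable_from_top.aemeasurable).symm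

lemma lintegral_comp_pointMeasure_pi [Fintype J] [IsProbabilityMeasure P]
    (h : IsPoissonPointProcess P lam X) (hC : ∀ j, MeasurableSet (C j))
    (hC' : ∀ j, volume (C j) ≠ ∞) (hd : Pairwise fun i j => Disjoint (C i) (C j))
    {F : (J → ℝ≥0∞) → ℝ≥0∞} (hF : Measurable F) :
    ∫⁻ ω, F (fun j => pointMeasure X ω (C j)) ∂P =
      ∫⁻ k, F (fun j => (k j : ℝ≥0∞))
        ∂Measure.pi fun j => poissonMeasure (intensity lam (C j)).toNNReal := by
  rw [← lintegral_map hF (measurable_pi_lambda _ fun j => h.measurable_pointMeasure_apply (hC j)),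
    h.map_pointMeasure_pi hC hC' hd, lintegral_map hF (measurable_of_countable _)]

lemma measurable_reducedPointMeasure (h : IsPoissonPointProcess P lam X) (n : ℕ) :
    Measurable (reducedPointMeasure X n) :=
  measurable_pointMeasure fun s => h.measurable s

lemma measurable_indicator_mul_comp_reducedPointMeasure (h : IsPoissonPointProcess P lam X)
    {ι : Type*} {A : Set Plane} (hA : MeasurableSet A) {B : ι → Set Plane}
    (hB : ∀ i, MeasurableSet (B i)) {F : (ι → ℝ≥0∞) → ℝ≥0∞} (hF : Measurable F) (n : ℕ) :
    Measurable fun ω =>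
      A.indicator 1 (X n ω) * F fun i => reducedPointMeasure X n ω (B i) :=
  ((measurable_one.indicator hA).comp (h.measurable n)).mul <|
    hF.comp <| measurable_pi_lambda _ fun i => (Measure.measurable_coe (hB i)).comp
      (h.measurable_reducedPointMeasure n)

lemma tsum_lintegral_indicator_mul_of_disjoint [Finite J] [IsProbabilityMeasure P]
    (h : IsPoissonPointProcess P lam X) (hC : ∀ j, MeasurableSet (C j))
    (hC' : ∀ j, volume (C j) ≠ ∞) (hd : Pairwise fun i j => Disjoint (C i) (C j))
    {F : (J → ℝ≥0∞) → ℝ≥0∞} (hF : Measurable F) (i : J) :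
    ∑' n, ∫⁻ ω, (C i).indicator 1 (X n ω) * F (fun j => reducedPointMeasure X n ω (C j)) ∂P =
      intensity lam (C i) * ∫⁻ ω, F (fun j => pointMeasure X ω (C j)) ∂P := by
  classical
  have := Fintype.ofFinite J
  rw [← lintegral_tsum fun n =>
    (h.measurable_indicator_mul_comp_reducedPointMeasure (hC i) hC hF n).aemeasurable]
  simp_rw [tsum_indicator_mul_comp_reducedPointMeasure hC hd F i]
  have hbias : Measurable fun v : J → ℝ≥0∞ => v i * F (v - Pi.single i 1) :=
    (measurable_pi_apply i).mul (hF.comp (measurable_id.sub_const _))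
  rw [h.lintegral_comp_pointMeasure_pi hC hC' hd hbias,
    h.lintegral_comp_pointMeasure_pi hC hC' hd hF,
    ← ENNReal.coe_toNNReal (intensity_ne_top lam (hC' i))]
  refine .trans (lintegral_congr fun k => ?_) (lintegral_mul_comp_sub_single_pi_poissonMeasure
    (fun j => (intensity lam (C j)).toNNReal) i fun k => F fun j => (k j : ℝ≥0∞))
  congr 2
  funext j
  rcases eq_or_ne j i with rfl | hj
  · simp
  · simp [hj]

lemma lintegral_negExp_sum_mul_pointMeasure [Fintype J] [IsProbabilityMeasure P]
    (h : IsPoissonPointProcess P lam X) (hC : ∀ j, MeasurableSet (C j))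
    (hC' : ∀ j, volume (C j) ≠ ∞) (hd : Pairwise fun i j => Disjoint (C i) (C j))
    (c : J → ℝ≥0∞) :
    ∫⁻ ω, negExp (∑ j, c j * pointMeasure X ω (C j)) ∂P =
      negExp (∑ j, (1 - negExp (c j)) * intensity lam (C j)) := by
  have hm (j : J) : Measurable fun x => negExp (c j * x) :=
    measurable_negExp.comp (measurable_const_mul _)
  simp_rw [negExp_sum]
  refine (lintegral_prod_eq_prod_lintegral_of_indepFun Finset.univ _
    ((h.iIndepFun_pointMeasure hC hC' hd).comp _ hm)
    fun j => (hm j).comp (h.measurable_pointMeasure_apply (hC j))).trans ?_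
  refine Finset.prod_congr rfl fun j _ => ?_
  refine (h.lintegral_natCast_comp_pointMeasure (hC j) (hC' j) (hm j)).trans ?_
  simp_rw [negExp_mul_natCast, lintegral_pow_poissonMeasure _ (negExp_le_one _)]
  rw [ENNReal.coe_toNNReal (intensity_ne_top lam (hC' j)), mul_comm]

end cells

lemma tsum_lintegral_indicator_mul [IsProbabilityMeasure P] (h : IsPoissonPointProcess P lam X)
    {ι : Type*} [Finite ι] {B : ι → Set Plane} (hB : ∀ i, MeasurableSet (B i))
    (hB' : ∀ i, volume (B i) ≠ ∞) {F : (ι → ℝ≥0∞) → ℝ≥0∞} (hF : Measurable F) (i : ι) :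
    ∑' n, ∫⁻ ω, (B i).indicator 1 (X n ω) * F (fun j => reducedPointMeasure X n ω (B j)) ∂P =
      intensity lam (B i) * ∫⁻ ω, F (fun j => pointMeasure X ω (B j)) ∂P := by
  classical
  have := Fintype.ofFinite {l : ι → Prop // ∃ i, l i}
  let C (l : {l : ι → Prop // ∃ i, l i}) : Set Plane := memberCell B l
  have hC l : MeasurableSet (C l) := measurableSet_memberCell hB l
  let G (v : {l : ι → Prop // ∃ i, l i} → ℝ≥0∞) : ℝ≥0∞ := F fun j => ∑ l, if l.1 j then v l else 0
  have hG : Measurable G := hF.comp <| measurable_pi_lambda _ fun j =>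
    Finset.measurable_sum _ fun l _ => by split_ifs <;> fun_prop
  have hFG (μ : Measure Plane) : F (fun j => μ (B j)) = G fun l => μ (C l) := by
    simp only [G, C, ← measure_eq_sum_memberCell hB μ]
  have hcell l : ∑' n, ∫⁻ ω, (C l).indicator 1 (X n ω) *
      G (fun l => reducedPointMeasure X n ω (C l)) ∂P =
        intensity lam (C l) * ∫⁻ ω, G (fun l => pointMeasure X ω (C l)) ∂P :=
    h.tsum_lintegral_indicator_mul_of_disjoint hC
      (fun l => measure_ne_top_of_subset (memberCell_subset l.2.choose_spec) (hB' _))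
      (fun l l' hl => disjoint_memberCell fun he => hl (Subtype.ext he)) hG l
  simp_rw [hFG, indicator_eq_sum_memberCell hB, measure_eq_sum_memberCell hB (intensity lam) i,
    Finset.sum_mul, ite_mul, zero_mul, ← Finset.sum_filter]
  refine (tsum_congr fun n => lintegral_finsetSum _ fun l _ =>
    h.measurable_indicator_mul_comp_reducedPointMeasure (hC l) hC hG n).trans ?_
  rw [Summable.tsum_finsetSum fun l _ => ENNReal.summable]
  exact Finset.sum_congr rfl fun l _ => hcell l

lemma tsum_measure_preimage_inter_preimage_reducedPointMeasure [IsProbabilityMeasure P]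
    (h : IsPoissonPointProcess P lam X) {A : Set Plane} (hA : MeasurableSet A)
    (hA' : volume A ≠ ∞) {D : Set (Measure Plane)} (hD : D ∈ countEvents volume) :
    ∑' n, P (X n ⁻¹' A ∩ reducedPointMeasure X n ⁻¹' D) =
      intensity lam A * P (pointMeasure X ⁻¹' D) := by
  classical
  have hDm := measurableSet_of_mem_countEvents hD
  obtain ⟨_, hU, rfl⟩ := hD
  obtain ⟨s, V, hV, rfl⟩ := (mem_measurableCylinders _).1 hU
  let a : {B : Set Plane // MeasurableSet B ∧ volume B ≠ ∞} := ⟨A, hA, hA'⟩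
  let S := insert a s
  let F (v : S → ℝ≥0∞) : ℝ≥0∞ := V.indicator 1 fun B : s => v ⟨B, Finset.mem_insert_of_mem B.2⟩
  have hF : Measurable F := (measurable_one.indicator hV).comp (by fun_prop)
  have hmecke := h.tsum_lintegral_indicator_mul (B := fun B : S => B.1.1) (fun B => B.1.2.1)
    (fun B => B.1.2.2) hF ⟨a, Finset.mem_insert_self a s⟩
  rw [← lintegral_indicator_one (measurable_pointMeasure h.measurable hDm)]
  refine .trans (tsum_congr fun n => ?_) hmecke
  rw [← lintegral_indicator_one ((h.measurable n hA).inter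
    (h.measurable_reducedPointMeasure n hDm))]
  simp_rw [Set.inter_indicator_one]
  rfl

theorem sum_map_prodMk_reducedPointMeasure [IsProbabilityMeasure P]
    (h : IsPoissonPointProcess P lam X) :
    Measure.sum (fun n => P.map fun ω => (X n ω, reducedPointMeasure X n ω)) =
      (intensity lam).prod (P.map (pointMeasure X)) := by
  have hX := measurable_pointMeasure h.measurable
  have := Measure.isProbabilityMeasure_map (μ := P) hX.aemeasurable
  let spanA : (intensity lam).FiniteSpanningSetsIn {A | MeasurableSet A ∧ volume A ≠ ∞} :=
    { set := spanningSets volume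
      set_mem := fun n => ⟨measurableSet_spanningSets _ n, (measure_spanningSets_lt_top _ n).ne⟩
      finite := fun n => (intensity_ne_top lam (measure_spanningSets_lt_top _ n).ne).lt_top
      spanning := iUnion_spanningSets _ }
  let spanD : (P.map (pointMeasure X)).FiniteSpanningSetsIn (countEvents volume) :=
    { set := fun _ => Set.univ
      set_mem := fun _ => ⟨Set.univ, univ_mem_measurableCylinders _, rfl⟩
      finite := fun _ => measure_lt_top _ _
      spanning := Set.iUnion_const _ }
  refine (Measure.prod_eq_generateFrom
    (generateFrom_measurableSet_measure_ne_top volume) generateFrom_countEvents ?_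
    isPiSystem_countEvents spanA spanD ?_).symm
  · exact fun A hA B hB _ => ⟨hA.1.inter hB.1, measure_ne_top_of_subset Set.inter_subset_left hA.2⟩
  · rintro A ⟨hA, hA'⟩ D hD
    have hD' := measurableSet_of_mem_countEvents hD
    rw [Measure.sum_apply _ (hA.prod hD'), Measure.map_apply hX hD',
      ← h.tsum_measure_preimage_inter_preimage_reducedPointMeasure hA hA' hD]
    refine tsum_congr fun n => ?_
    rw [Measure.map_apply ((h.measurable n).prodMk (h.measurable_reducedPointMeasure n))
      (hA.prod hD')]
    rfl

lemma lintegral_negExp_lintegral_simpleFunc [IsProbabilityMeasure P]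
    (h : IsPoissonPointProcess P lam X) (f : SimpleFunc Plane ℝ≥0∞) {S : Set Plane}
    (hS : MeasurableSet S) (hS' : volume S ≠ ∞) :
    ∫⁻ ω, negExp (∫⁻ z in S, f z ∂pointMeasure X ω) ∂P =
      negExp (∫⁻ z in S, 1 - negExp (f z) ∂intensity lam) := by
  let C (c : f.range) : Set Plane := f ⁻¹' {c.1} ∩ S
  have hC c : MeasurableSet (C c) := (f.measurableSet_fiber c.1).inter hS
  have hC' c : volume (C c) ≠ ∞ := measure_ne_top_of_subset Set.inter_subset_right hS'
  have hd : Pairwise fun c c' => Disjoint (C c) (C c') := fun c c' hc =>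
    Set.disjoint_left.2 fun z hz hz' => hc (Subtype.ext (hz.1.symm.trans hz'.1))
  have hsum (g : ℝ≥0∞ → ℝ≥0∞) (μ : Measure Plane) :
      ∫⁻ z in S, g (f z) ∂μ = ∑ c : f.range, g c * μ (C c) := by
    have := (f.map g).lintegral_eq_lintegral (μ.restrict S)
    simp only [SimpleFunc.coe_map, Function.comp_apply] at this
    rw [this, SimpleFunc.map_lintegral, ← Finset.sum_coe_sort]
    simp only [Measure.restrict_apply (f.measurableSet_fiber _), C]
  rw [hsum fun x => 1 - negExp x, ← h.lintegral_negExp_sum_mul_pointMeasure hC hC' hd]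
  exact lintegral_congr fun ω => congrArg negExp (hsum id _)

theorem lintegral_negExp_lintegral_pointMeasure [IsProbabilityMeasure P]
    (h : IsPoissonPointProcess P lam X) {f : Plane → ℝ≥0∞} (hf : Measurable f) :
    ∫⁻ ω, negExp (∫⁻ z, f z ∂pointMeasure X ω) ∂P =
      negExp (∫⁻ z, 1 - negExp (f z) ∂intensity lam) := by
  have hlim := SimpleFunc.tendsto_eapprox hf
  have hmono : Monotone fun n z => SimpleFunc.eapprox f n z := SimpleFunc.monotone_eapprox f
  have hsimple (n : ℕ) := h.lintegral_negExp_lintegral_simpleFunc (SimpleFunc.eapprox f n)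
    (measurableSet_spanningSets volume n) (measure_spanningSets_lt_top _ n).ne
  have hleft : Tendsto (fun n => ∫⁻ ω, negExp (∫⁻ z in spanningSets volume n,
      SimpleFunc.eapprox f n z ∂pointMeasure X ω) ∂P) atTop
      (𝓝 (∫⁻ ω, negExp (∫⁻ z, f z ∂pointMeasure X ω) ∂P)) := by
    refine tendsto_lintegral_of_dominated_convergence 1 (fun n => measurable_negExp.comp ?_)
      (fun n => ae_of_all _ fun ω => negExp_le_one _) (by simp) (ae_of_all _ fun ω => ?_)
    · simp_rw [← lintegral_indicator (measurableSet_spanningSets _ _)]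
      exact (Measure.measurable_lintegral ((SimpleFunc.measurable _).indicator
        (measurableSet_spanningSets _ n))).comp (measurable_pointMeasure h.measurable)
    · exact (continuous_negExp.tendsto _).comp
        (tendsto_setLIntegral_spanningSets volume _ (fun n => (SimpleFunc.measurable _)) hmono hlim)
  refine tendsto_nhds_unique hleft (Tendsto.congr (fun n => (hsimple n).symm) ?_)
  refine (continuous_negExp.tendsto _).comp (tendsto_setLIntegral_spanningSets volume _
    (fun n => measurable_const.sub (measurable_negExp.comp (SimpleFunc.measurable _)))
    (fun m n hmn z => tsub_le_tsub_left (antitone_negExp (hmono hmn z)) _) fun z => ?_)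
  exact ENNReal.Tendsto.sub tendsto_const_nhds ((continuous_negExp.tendsto _).comp (hlim z))
    (Or.inl ENNReal.one_ne_top)

/-- Mecke's formula: seen from a typical point, the other points form a Poisson point process of the
same intensity. -/
theorem tsum_lintegral_comp_reducedPointMeasure [IsProbabilityMeasure P]
    (h : IsPoissonPointProcess P lam X) {F : Plane × Measure Plane → ℝ≥0∞}
    (hF : AEMeasurable F ((intensity lam).prod (P.map (pointMeasure X)))) :
    ∑' n, ∫⁻ ω, F (X n ω, reducedPointMeasure X n ω) ∂P =
      ∫⁻ x, ∫⁻ ω, F (x, pointMeasure X ω) ∂P ∂intensity lam := by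
  have hpair (n : ℕ) : Measurable fun ω => (X n ω, reducedPointMeasure X n ω) :=
    (h.measurable n).prodMk (h.measurable_reducedPointMeasure n)
  have hX := measurable_pointMeasure h.measurable
  have hsum := h.sum_map_prodMk_reducedPointMeasure
  calc ∑' n, ∫⁻ ω, F (X n ω, reducedPointMeasure X n ω) ∂P
      = ∑' n, ∫⁻ y, F y ∂P.map fun ω => (X n ω, reducedPointMeasure X n ω) := by
        refine tsum_congr fun n => (lintegral_map' (hF.mono_measure ?_) (hpair n).aemeasurable).symm
        exact hsum ▸ Measure.le_sum _ n
    _ = ∫⁻ x, ∫⁻ μ, F (x, μ) ∂P.map (pointMeasure X) ∂intensity lam := by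
        rw [← lintegral_sum_measure, hsum, lintegral_prod _ hF]
    _ = _ := by
        refine lintegral_congr_ae ?_
        filter_upwards [Measure.ae_ae_of_ae_prod hF.ae_eq_mk] with x hx
        have hmk : Measurable fun μ => hF.mk F (x, μ) :=
          hF.measurable_mk.comp measurable_prodMk_left
        exact lintegral_map' ⟨_, hmk, hx⟩ hX.aemeasurable

theorem tsum_lintegral_indicator_mul_negExp [IsProbabilityMeasure P]
    (h : IsPoissonPointProcess P lam X) {A : Set Plane} (hA : MeasurableSet A)
    {g : Plane → Plane → ℝ≥0∞} (hg : Measurable (Function.uncurry g)) :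
    ∑' n, ∫⁻ ω, A.indicator 1 (X n ω) *
        negExp (∑' s, if s = n then 0 else g (X n ω) (X s ω)) ∂P =
      ∫⁻ x in A, negExp (∫⁻ z, 1 - negExp (g x z) ∂intensity lam) ∂intensity lam := by
  let F (y : Plane × Measure Plane) := A.indicator 1 y.1 * negExp (∫⁻ z, g y.1 z ∂y.2)
  have hF : AEMeasurable F ((intensity lam).prod (P.map (pointMeasure X))) := by
    refine ((measurable_one.indicator hA).comp measurable_fst).aemeasurable.mul
      (measurable_negExp.comp_aemeasurable (aemeasurable_lintegral_prodMk
        (measurableSet_spanningSets volume) (monotone_spanningSets volume)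
        (iUnion_spanningSets volume) (fun k => ?_) hg))
    have hk : MeasurableSet {μ : Measure Plane | μ (spanningSets volume k) ≠ ∞} :=
      Measure.measurable_coe (measurableSet_spanningSets volume k) (measurableSet_singleton ∞).compl
    exact Measure.quasiMeasurePreserving_snd.ae <|
      (ae_map_iff (measurable_pointMeasure h.measurable).aemeasurable hk).2 <|
        h.ae_pointMeasure_ne_top (measurableSet_spanningSets volume k)
          (measure_spanningSets_lt_top volume k).ne
  have hgx (x : Plane) : Measurable (g x) := hg.comp measurable_prodMk_left
  have hsum (n : ℕ) (ω : Ω) : F (X n ω, reducedPointMeasure X n ω) = A.indicator 1 (X n ω) *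
      negExp (∑' s, if s = n then 0 else g (X n ω) (X s ω)) := by
    simp only [F, reducedPointMeasure, lintegral_pointMeasure (hgx _)]
    congr 2
    refine (tsum_subtype {s | s ≠ n} fun s => g (X n ω) (X s ω)).trans (tsum_congr fun s => ?_)
    by_cases hs : s = n <;> simp [hs]
  simp_rw [← hsum, h.tsum_lintegral_comp_reducedPointMeasure hF, F]
  rw [← lintegral_indicator hA]
  refine lintegral_congr fun x => ?_
  by_cases hx : x ∈ A
  · simpa [hx] using h.lintegral_negExp_lintegral_pointMeasure (hgx x)
  · simp [hx]

lemma tsum_measure_preimage [IsProbabilityMeasure P] (h : IsPoissonPointProcess P lam X)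
    {A : Set Plane} (hA : MeasurableSet A) : ∑' n, P (X n ⁻¹' A) = intensity lam A := by
  simpa [← Set.indicator_comp_right, Function.comp_def,
    lintegral_indicator_fun_one, h.measurable _ hA]
    using h.tsum_lintegral_indicator_mul_negExp hA (g := 0) measurable_const

end IsPoissonPointProcess

/-! ### Rayleigh fading and path loss -/

section rayleigh

variable {σ : ℝ}

lemma lintegral_Ioi_mul_exp_neg_sq (hσ : 0 < σ) {b y : ℝ} (hb : 0 < b) (hy : 0 ≤ y) :
    ∫⁻ x in Set.Ioi y, ENNReal.ofReal (x / σ ^ 2 * Real.exp (-(b * x ^ 2 / (2 * σ ^ 2)))) =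
      ENNReal.ofReal (Real.exp (-(b * y ^ 2 / (2 * σ ^ 2))) / b) := by
  have hderiv : ∀ x ∈ Set.Ici y, HasDerivAt
      (fun x : ℝ => -(Real.exp (-(b * x ^ 2 / (2 * σ ^ 2))) / b))
      (x / σ ^ 2 * Real.exp (-(b * x ^ 2 / (2 * σ ^ 2)))) x := by
    intro x _
    have hexponent : HasDerivAt (fun x : ℝ => -(b * x ^ 2 / (2 * σ ^ 2)))
        (-(b * (2 * x) / (2 * σ ^ 2))) x := by
      simpa using (((hasDerivAt_pow 2 x).const_mul b).div_const (2 * σ ^ 2)).fun_neg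
    convert! (hexponent.exp.div_const b).neg using 1
    field_simp
  have hpos : ∀ x ∈ Set.Ioi y, 0 ≤ x / σ ^ 2 * Real.exp (-(b * x ^ 2 / (2 * σ ^ 2))) :=
    fun x hx => by
      have : 0 ≤ x := hy.trans (le_of_lt hx)
      positivity
  have hlim : Tendsto (fun x : ℝ => -(Real.exp (-(b * x ^ 2 / (2 * σ ^ 2))) / b)) atTop (𝓝 0) := by
    have hexponent : Tendsto (fun x : ℝ => b * x ^ 2 / (2 * σ ^ 2)) atTop atTop :=
      ((tendsto_pow_atTop two_ne_zero).const_mul_atTop hb).atTop_div_const (by positivity)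
    simpa using ((Real.tendsto_exp_neg_atTop_nhds_zero.comp hexponent).div_const b).neg
  rw [← ofReal_integral_eq_lintegral_ofReal
      (integrableOn_Ioi_deriv_of_nonneg' hderiv hpos hlim)
      ((ae_restrict_iff' measurableSet_Ioi).2 (ae_of_all _ hpos)),
    integral_Ioi_of_hasDerivAt_of_nonneg' hderiv hpos hlim]
  simp

lemma rayleighMeasure_eq_withDensity_restrict_Ioi (σ : ℝ) : rayleighMeasure σ =
    (volume.restrict (Set.Ioi 0)).withDensity fun x =>
      ENNReal.ofReal (x / σ ^ 2 * Real.exp (-(x ^ 2 / (2 * σ ^ 2)))) := by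
  rw [← withDensity_indicator measurableSet_Ioi, rayleighMeasure]
  congr 1
  funext x
  rcases lt_trichotomy x 0 with hx | rfl | hx
  · simp [hx.not_ge, hx.le]
  · simp
  · simp [hx, hx.le, neg_div]

lemma rayleighMeasure_Ioi (hσ : 0 < σ) {y : ℝ} (hy : 0 ≤ y) :
    rayleighMeasure σ (Set.Ioi y) = ENNReal.ofReal (Real.exp (-(y ^ 2 / (2 * σ ^ 2)))) := by
  rw [rayleighMeasure_eq_withDensity_restrict_Ioi, withDensity_apply _ measurableSet_Ioi,
    Measure.restrict_restrict measurableSet_Ioi, Set.inter_eq_left.2 (Set.Ioi_subset_Ioi hy)]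
  simpa using lintegral_Ioi_mul_exp_neg_sq hσ one_pos hy

lemma rayleighMeasure_setOf_lt_mul_sq (hσ : 0 < σ) {b : ℝ} (hb : 0 < b) (a : ℝ≥0∞) :
    rayleighMeasure σ {x | a < ENNReal.ofReal b * ENNReal.ofReal x ^ 2} =
      negExp (ENNReal.ofReal (1 / (b * (2 * σ ^ 2))) * a) := by
  induction a with
  | top => simp [hσ, hb]
  | coe a =>
    have hset : {x : ℝ | (a : ℝ≥0∞) < ENNReal.ofReal b * ENNReal.ofReal x ^ 2} =
        Set.Ioi (√(a / b)) := by
      ext x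
      rw [Set.mem_ofPred_eq, Set.mem_Ioi]
      rcases le_or_gt x 0 with hx | hx
      · simpa [ENNReal.ofReal_of_nonpos hx] using hx.trans (Real.sqrt_nonneg (a / b))
      · rw [← ENNReal.ofReal_coe_nnreal, ← ENNReal.ofReal_pow hx.le, ← ENNReal.ofReal_mul hb.le,
          ENNReal.ofReal_lt_ofReal_iff (by positivity), Real.sqrt_lt' hx, div_lt_iff₀ hb, mul_comm]
    rw [hset, rayleighMeasure_Ioi hσ (Real.sqrt_nonneg _), Real.sq_sqrt (by positivity),
      ← negExp_ofReal (by positivity), ← ENNReal.ofReal_coe_nnreal,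
      ← ENNReal.ofReal_mul (by positivity)]
    congr 2
    field_simp

/-- The squared Rayleigh fading is exponentially distributed with mean `2 σ ^ 2`. -/
lemma lintegral_negExp_mul_sq_rayleighMeasure (hσ : 0 < σ) (a : ℝ≥0∞) :
    ∫⁻ x, negExp (ENNReal.ofReal (1 / (2 * σ ^ 2)) * a * ENNReal.ofReal x ^ 2) ∂rayleighMeasure σ =
      (1 + a)⁻¹ := by
  have hm : Measurable fun x : ℝ =>
      negExp (ENNReal.ofReal (1 / (2 * σ ^ 2)) * a * ENNReal.ofReal x ^ 2) :=
    measurable_negExp.comp (by fun_prop)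
  rw [rayleighMeasure_eq_withDensity_restrict_Ioi,
    lintegral_withDensity_eq_lintegral_mul _ (by fun_prop) hm]
  induction a with
  | top =>
    rw [setLIntegral_congr_fun (g := fun _ => 0) measurableSet_Ioi fun x hx => ?_]
    · simp
    · have hx' : (0 : ℝ) < x := hx
      simp only [Pi.mul_apply]
      rw [ENNReal.mul_top (by simpa using by positivity), ENNReal.top_mul (by simpa using hx'),
        negExp_top, mul_zero]
  | coe a =>
    rw [setLIntegral_congr_fun measurableSet_Ioi fun x hx => ?_]
    · refine (lintegral_Ioi_mul_exp_neg_sq hσ (b := 1 + a) (by positivity) le_rfl).trans ?_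
      rw [ENNReal.ofReal_div_of_pos (by positivity), ENNReal.ofReal_add zero_le_one a.coe_nonneg]
      simp
    · have hx' : (0 : ℝ) < x := hx
      rw [Pi.mul_apply, ← ENNReal.ofReal_coe_nnreal, ← ENNReal.ofReal_mul (by positivity),
        ← ENNReal.ofReal_pow hx'.le, ← ENNReal.ofReal_mul (by positivity),
        negExp_ofReal (by positivity), ← ENNReal.ofReal_mul (by positivity), mul_assoc,
        ← Real.exp_add]
      congr 4
      field_simp
      ring

end rayleigh

section pathLoss

lemma lintegral_Ioi_rpow_mul_exp_neg_mul_rpow {p q b : ℝ} (hp : 0 < p) (hq : -1 < q) (hb : 0 < b) :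
    ∫⁻ x in Set.Ioi (0 : ℝ), ENNReal.ofReal (x ^ q * Real.exp (-b * x ^ p)) =
      ENNReal.ofReal (b ^ (-(q + 1) / p) * (1 / p) * Real.Gamma ((q + 1) / p)) := by
  rw [← integral_rpow_mul_exp_neg_mul_rpow hp hq hb, ofReal_integral_eq_lintegral_ofReal]
  · exact integrableOn_rpow_mul_exp_neg_mul_rpow hq hp hb
  · refine (ae_restrict_iff' measurableSet_Ioi).2 (ae_of_all _ fun x hx => ?_)
    have : (0 : ℝ) < x := hx
    simp only [Pi.zero_apply]
    positivity

lemma lintegral_Ioi_mul_exp_neg_mul {y b : ℝ} (hy : 0 ≤ y) (hb : 0 < b) :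
    ∫⁻ x in Set.Ioi (0 : ℝ), ENNReal.ofReal (y * Real.exp (-(b * x))) = ENNReal.ofReal (y / b) := by
  simp_rw [ENNReal.ofReal_mul hy]
  rw [lintegral_const_mul _ (by fun_prop), div_eq_mul_inv, ENNReal.ofReal_mul hy]
  congr 1
  simpa [Real.rpow_neg_one] using
    lintegral_Ioi_rpow_mul_exp_neg_mul_rpow one_pos (q := 0) (by norm_num) hb

variable {a α c : ℝ}

lemma lintegral_Ioi_mul_rpow_mul_exp_neg (ha : 0 < a) (hα : 0 < α) (hc : 0 < c) {x : ℝ}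
    (hx : 0 < x) :
    ∫⁻ r in Set.Ioi (0 : ℝ), ENNReal.ofReal (c * r ^ (a - 1) * Real.exp (-((r ^ α + c) * x))) =
      ENNReal.ofReal (c / α * Real.Gamma (a / α)) *
        ENNReal.ofReal (x ^ (-(a / α)) * Real.exp (-c * x ^ (1 : ℝ))) := by
  have hsplit (r : ℝ) : ENNReal.ofReal (c * r ^ (a - 1) * Real.exp (-((r ^ α + c) * x))) =
      ENNReal.ofReal (c * Real.exp (-c * x)) *
        ENNReal.ofReal (r ^ (a - 1) * Real.exp (-x * r ^ α)) := by
    rw [← ENNReal.ofReal_mul (by positivity),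
      show -((r ^ α + c) * x) = -c * x + -x * r ^ α by ring, Real.exp_add]
    ring_nf
  have := Real.Gamma_pos_of_pos (div_pos ha hα)
  simp_rw [hsplit]
  rw [lintegral_const_mul _ (by fun_prop),
    lintegral_Ioi_rpow_mul_exp_neg_mul_rpow hα (by linarith) hx,
    ← ENNReal.ofReal_mul (by positivity), ← ENNReal.ofReal_mul (by positivity),
    sub_add_cancel, neg_div, Real.rpow_one]
  ring_nf

/-- Write `1 / (r ^ α + c)` as an integral of exponentials and exchange the integrals; the result
is a product of Gamma values, to which Euler's reflection formula applies. -/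
lemma lintegral_Ioi_rpow_mul_div_rpow_add (ha : 0 < a) (haα : a < α) (hc : 0 < c) :
    ∫⁻ r in Set.Ioi (0 : ℝ), ENNReal.ofReal (r ^ (a - 1) * (c / (r ^ α + c))) =
      ENNReal.ofReal (c ^ (a / α) * (Real.pi / (α * Real.sin (Real.pi * (a / α))))) := by
  have hα : 0 < α := ha.trans haα
  have := Real.Gamma_pos_of_pos (div_pos ha hα)
  have hexp : ∀ r ∈ Set.Ioi (0 : ℝ), ENNReal.ofReal (r ^ (a - 1) * (c / (r ^ α + c))) =
      ∫⁻ x in Set.Ioi (0 : ℝ),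
        ENNReal.ofReal (c * r ^ (a - 1) * Real.exp (-((r ^ α + c) * x))) := by
    intro r hr
    have hr' : (0 : ℝ) < r := hr
    rw [lintegral_Ioi_mul_exp_neg_mul (by positivity) (by positivity)]
    ring_nf
  rw [setLIntegral_congr_fun measurableSet_Ioi hexp,
    lintegral_lintegral_swap (by simp only [Function.uncurry_def]; fun_prop),
    setLIntegral_congr_fun measurableSet_Ioi fun x hx =>
      lintegral_Ioi_mul_rpow_mul_exp_neg ha hα hc hx,
    lintegral_const_mul _ (by fun_prop), lintegral_Ioi_rpow_mul_exp_neg_mul_rpow one_pos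
      (by rwa [neg_lt_neg_iff, div_lt_one hα]) hc, ← ENNReal.ofReal_mul (by positivity)]
  congr 1
  rw [div_one, div_one, neg_add, neg_neg, Real.rpow_add hc, Real.rpow_neg_one, ← sub_eq_neg_add]
  calc _ = c ^ (a / α) / α * (Real.Gamma (a / α) * Real.Gamma (1 - a / α)) := by field_simp
    _ = _ := by rw [Real.Gamma_mul_Gamma_one_sub]; field_simp

lemma sin_two_mul_pi_div_pos (hα : 2 < α) : 0 < Real.sin (2 * Real.pi / α) := by
  have hα0 : 0 < α := two_pos.trans hα
  refine Real.sin_pos_of_pos_of_lt_pi (by positivity) ?_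
  rw [div_lt_iff₀ hα0]
  nlinarith [Real.pi_pos]

lemma lintegral_plane_div_norm_rpow_add (hα : 2 < α) (hc : 0 < c) :
    ∫⁻ z : Plane, ENNReal.ofReal (c / (‖z‖ ^ α + c)) =
      ENNReal.ofReal (c ^ (2 / α) * pathLossConst α) := by
  have : 0 < α := two_pos.trans hα
  have hsin := sin_two_mul_pi_div_pos hα
  have hradial : ∫⁻ r in Set.Ioi (0 : ℝ), ENNReal.ofReal (r * (c / (r ^ α + c))) =
      ENNReal.ofReal (c ^ (2 / α) * (Real.pi / (α * Real.sin (2 * Real.pi / α)))) := by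
    simpa only [show (2 : ℝ) - 1 = 1 by norm_num, Real.rpow_one, mul_div_left_comm Real.pi 2 α,
      ← mul_div_assoc 2 Real.pi α] using lintegral_Ioi_rpow_mul_div_rpow_add two_pos hα hc
  have hpos : 0 ≤ᵐ[volume.restrict (Set.Ioi (0 : ℝ))] fun r => r * (c / (r ^ α + c)) :=
    (ae_restrict_iff' measurableSet_Ioi).2 <| ae_of_all _ fun r (hr : 0 < r) => by
      simp only [Pi.zero_apply]
      positivity
  have hmeas : Measurable fun r : ℝ => r * (c / (r ^ α + c)) := by fun_prop
  have hintegrable : IntegrableOn (fun r : ℝ => r * (c / (r ^ α + c))) (Set.Ioi 0) := by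
    refine ⟨hmeas.aestronglyMeasurable, ?_⟩
    rw [hasFiniteIntegral_iff_ofReal hpos, hradial]
    exact ENNReal.ofReal_lt_top
  have hdim : Module.finrank ℝ Plane = 2 := finrank_euclideanSpace_fin
  have hplane : Integrable fun z : Plane => c / (‖z‖ ^ α + c) := by
    rw [integrable_fun_norm_addHaar volume (f := fun r : ℝ => c / (r ^ α + c)), hdim]
    simpa using hintegrable
  rw [← ofReal_integral_eq_lintegral_ofReal hplane (ae_of_all _ fun z => by
    simp only [Pi.zero_apply]; positivity)]
  congr 1
  rw [integral_fun_norm_addHaar volume fun r : ℝ => c / (r ^ α + c), hdim]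
  simp only [Nat.add_one_sub_one, pow_one, smul_eq_mul, nsmul_eq_mul]
  rw [integral_eq_lintegral_of_nonneg_ae hpos hmeas.aestronglyMeasurable, hradial,
    ENNReal.toReal_ofReal (by positivity), measureReal_def, EuclideanSpace.volume_ball_fin_two,
    pathLossConst]
  simp only [ENNReal.ofReal_one, one_pow, one_mul, Nat.cast_ofNat,
    ENNReal.toReal_ofReal Real.pi_nonneg]
  field_simp

lemma lintegral_plane_one_sub_inv_one_add (hα : 2 < α) (hc : 0 < c) :
    ∫⁻ z : Plane, (1 - (1 + ENNReal.ofReal c * ‖z‖ₑ ^ (-α))⁻¹) =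
      ENNReal.ofReal (c ^ (2 / α) * pathLossConst α) := by
  rw [← lintegral_plane_div_norm_rpow_add hα hc]
  refine lintegral_congr_ae ?_
  filter_upwards [compl_mem_ae_iff.2 (measure_singleton (0 : Plane))] with z hz
  have hz' : 0 < ‖z‖ := norm_pos_iff.2 hz
  rw [← ofReal_norm, ENNReal.ofReal_rpow_of_pos hz', ← ENNReal.ofReal_mul hc.le,
    ← ENNReal.ofReal_one, ← ENNReal.ofReal_add zero_le_one (by positivity),
    ← ENNReal.ofReal_inv_of_pos (by positivity), ← ENNReal.ofReal_sub _ (by positivity),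
    Real.rpow_neg hz'.le]
  congr 1
  field_simp
  ring

end pathLoss

/-! ### Independent sources of randomness -/

section independence

variable {Ω ι κ : Type*} {mΩ : MeasurableSpace Ω} {P : Measure Ω} {m : ι → MeasurableSpace Ω}

lemma iIndep_of_iIndep_fibers [Finite κ] {G : κ → MeasurableSpace Ω} (kind : ι → κ)
    (hG : iIndep G P) (hle : ∀ i, m i ≤ G (kind i))
    (hin : ∀ k, iIndep (fun i : {i // kind i = k} => m i) P) : iIndep m P := by
  classical
  have := Fintype.ofFinite κ
  refine (iIndep_iff _ _).2 fun S f hf => ?_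
  have hsplit : ⋂ i ∈ S, f i =
      ⋂ k ∈ (Finset.univ : Finset κ), ⋂ i ∈ S.subtype (kind · = k), f i := by
    ext ω
    simp only [Set.mem_iInter, Finset.mem_univ, true_implies, Finset.mem_subtype, Subtype.forall]
    exact ⟨fun h k i _ hi => h i hi, fun h i hi => h _ i rfl hi⟩
  rw [hsplit, hG.meas_biInter, ← Finset.prod_fiberwise S kind]
  · refine Finset.prod_congr rfl fun k _ => ?_
    rw [(hin k).meas_biInter fun i hi => hf i (Finset.mem_subtype.1 hi),
      ← Finset.prod_subtype_eq_prod_filter]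
  · refine fun k _ => Finset.measurableSet_biInter _ fun i hi => ?_
    exact (hle i).trans_eq (congrArg G i.2) _ (hf i (Finset.mem_subtype.1 hi))

lemma iIndep_biSup_of_pairwise_disjoint (hle : ∀ i, m i ≤ mΩ) (h : iIndep m P) {S : κ → Set ι}
    (hS : Pairwise fun k l => Disjoint (S k) (S l)) : iIndep (fun k => ⨆ i ∈ S k, m i) P := by
  classical
  refine (iIndep_iff _ _).2 fun F f hf => ?_
  induction F using Finset.induction_on with
  | empty =>
    have := h.isProbabilityMeasure
    simp
  | insert k F hk ih =>
    have hdisj : Disjoint (S k) (⋃ l ∈ F, S l) :=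
      Set.disjoint_iUnion₂_right.2 fun l hl => hS (ne_of_mem_of_not_mem hl hk).symm
    have hmono : ∀ l ∈ F, ⨆ i ∈ S l, m i ≤ ⨆ i ∈ ⋃ l ∈ F, S l, m i := fun l hl =>
      biSup_mono fun i hi => Set.mem_biUnion hl hi
    have hF : MeasurableSet[⨆ i ∈ ⋃ l ∈ F, S l, m i] (⋂ l ∈ F, f l) :=
      .biInter F.countable_toSet fun l hl => hmono l hl _ (hf l (Finset.mem_insert_of_mem hl))
    rw [Finset.set_biInter_insert, Finset.prod_insert hk,
      ← ih fun l hl => hf l (Finset.mem_insert_of_mem hl)]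
    exact (Indep_iff _ _ P).1 (indep_iSup_of_disjoint hle h hdisj) _ _
      (hf k (Finset.mem_insert_self k F)) hF

lemma lintegral_comp_of_indepFun {β γ : Type*} [MeasurableSpace β] [MeasurableSpace γ]
    [IsFiniteMeasure P] {L : Ω → β} {Z : Ω → γ} (h : IndepFun L Z P) (hL : Measurable L)
    (hZ : Measurable Z) {φ : β → γ → ℝ≥0∞} (hφ : Measurable (Function.uncurry φ)) :
    ∫⁻ ω, φ (L ω) (Z ω) ∂P = ∫⁻ ω, ∫⁻ ω', φ (L ω) (Z ω') ∂P ∂P :=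
  calc ∫⁻ ω, φ (L ω) (Z ω) ∂P
    _ = ∫⁻ y, φ y.1 y.2 ∂P.map fun ω => (L ω, Z ω) := (lintegral_map hφ (hL.prodMk hZ)).symm
    _ = ∫⁻ l, ∫⁻ z, φ l z ∂P.map Z ∂P.map L := by
      rw [h.map_prod_eq_prod_map_map hL.aemeasurable hZ.aemeasurable]
      exact lintegral_prod _ hφ.aemeasurable
    _ = ∫⁻ ω, ∫⁻ z, φ (L ω) z ∂P.map Z ∂P := lintegral_map hφ.lintegral_prod_right' hL
    _ = ∫⁻ ω, ∫⁻ ω', φ (L ω) (Z ω') ∂P ∂P :=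
      lintegral_congr fun ω => lintegral_map (hφ.comp measurable_prodMk_left) hZ

lemma lintegral_negExp_tsum {f : ℕ → Ω → ℝ≥0∞} (hf : ∀ s, Measurable (f s))
    (h : iIndepFun f P) :
    ∫⁻ ω, negExp (∑' s, f s ω) ∂P = negExp (∑' s, negLog (∫⁻ ω, negExp (f s ω) ∂P)) := by
  have := h.isProbabilityMeasure
  have hprod : ∀ k, ∏ s ∈ Finset.range k, negExp (negLog (∫⁻ ω, negExp (f s ω) ∂P)) =
      ∫⁻ ω, ∏ s ∈ Finset.range k, negExp (f s ω) ∂P := fun k => by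
    have hle : ∀ s, ∫⁻ ω, negExp (f s ω) ∂P ≤ 1 := fun s =>
      (lintegral_mono fun ω => negExp_le_one _).trans (by simp)
    rw [lintegral_prod_eq_prod_lintegral_of_indepFun _ (fun s ω => negExp (f s ω))
      (h.comp (fun _ => negExp) fun _ => measurable_negExp) fun s => measurable_negExp.comp (hf s)]
    exact Finset.prod_congr rfl fun s _ => negExp_negLog (hle s)
  refine tendsto_nhds_unique ?_ ((tendsto_prod_negExp _).congr hprod)
  refine tendsto_lintegral_of_dominated_convergence (fun _ => 1) (fun k => ?_)
    (fun k => ae_of_all _ fun ω => ?_) (by simp) (ae_of_all _ fun ω => tendsto_prod_negExp _)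
  · exact Finset.measurable_fun_prod _ fun s _ => measurable_negExp.comp (hf s)
  · exact Finset.prod_le_one' fun s _ => negExp_le_one _

end independence

namespace HarvestingNetwork

/-- The independent sources of randomness of a network. The locations form a single source, since
the points of a Poisson process are not independent; so do the orientations, as only their
marginal laws matter. -/
inductive Source
  | loc
  | dir
  | fade (m s : ℕ)
  | init (m : ℕ)
  | arrival (m t : ℕ)
  | coin (m t : ℕ)

/-- The position of the group of a source in the list of independent σ-algebras of
`HarvestingNetwork.indep`. -/
def Source.kind : Source → Fin 6
  | .loc => 0
  | .dir => 1
  | .fade _ _ => 2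
  | .init _ => 3
  | .arrival _ _ => 4
  | .coin _ _ => 5

variable {Ω : Type*} [MeasurableSpace Ω] {P : Measure Ω} {lam p σ : ℝ}

/-- The σ-algebra of a source of randomness. -/
@[reducible]
noncomputable def sourceAlgebra (N : HarvestingNetwork P lam p σ) : Source → MeasurableSpace Ω
  | .loc => generated N.loc
  | .dir => generated N.dir
  | .fade m s => MeasurableSpace.comap (N.fade m s) inferInstance
  | .init m => MeasurableSpace.comap (N.init m) inferInstance
  | .arrival m t => MeasurableSpace.comap (N.arrival m t) inferInstance
  | .coin m t => MeasurableSpace.comap (N.coin m t) inferInstance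

/-- The information carried by the sources in `S`, as a σ-algebra. -/
@[reducible]
noncomputable def known (N : HarvestingNetwork P lam p σ) (S : Set Source) : MeasurableSpace Ω :=
  ⨆ i ∈ S, N.sourceAlgebra i

variable (N : HarvestingNetwork P lam p σ) {S T : Set Source}

lemma sourceAlgebra_le (i : Source) : N.sourceAlgebra i ≤ ‹MeasurableSpace Ω› := by
  cases i with
  | loc => exact iSup_le fun m => (N.loc_poisson.measurable m).comap_le
  | dir => exact iSup_le fun m => (N.dir_measurable m).comap_le
  | fade m s => exact (N.fade_measurable m s).comap_le
  | init m => exact (N.init_measurable m).comap_le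
  | arrival m t => exact (N.arrival_measurable m t).comap_le
  | coin m t => exact (N.coin_measurable m t).comap_le

lemma sourceAlgebra_le_generated (i : Source) : N.sourceAlgebra i ≤
    (![generated N.loc, generated N.dir, generated (fun i : ℕ × ℕ => N.fade i.1 i.2),
      generated N.init, generated (fun i : ℕ × ℕ => N.arrival i.1 i.2),
      generated (fun i : ℕ × ℕ => N.coin i.1 i.2)] : Fin 6 → MeasurableSpace Ω) i.kind := by
  cases i with
  | loc | dir => exact le_rfl
  | fade m s | arrival m s | coin m s => exact le_iSup_of_le (m, s) le_rfl
  | init m => exact le_iSup_of_le m le_rfl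

lemma iIndep_sourceAlgebra_of_kind_eq [IsProbabilityMeasure P] (k : Fin 6) :
    iIndep (fun i : {i : Source // i.kind = k} => N.sourceAlgebra i) P := by
  fin_cases k
  · have : Subsingleton {i : Source // i.kind = 0} :=
      ⟨fun ⟨i, hi⟩ ⟨j, hj⟩ => by cases i <;> cases hi; cases j <;> cases hj; rfl⟩
    exact iIndep.of_subsingleton (ι := {i : Source // i.kind = 0})
  · have : Subsingleton {i : Source // i.kind = 1} :=
      ⟨fun ⟨i, hi⟩ ⟨j, hj⟩ => by cases i <;> cases hi; cases j <;> cases hj; rfl⟩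
    exact iIndep.of_subsingleton (ι := {i : Source // i.kind = 1})
  · refine iIndep.of_precomp (g := fun i : ℕ × ℕ => ⟨.fade i.1 i.2, rfl⟩) (fun ⟨i, hi⟩ => ?_)
      ((iIndepFun_iff_iIndep ..).1 N.fade_indep)
    cases i <;> cases hi
    exact ⟨(_, _), rfl⟩
  · refine iIndep.of_precomp (g := fun i : ℕ => ⟨.init i, rfl⟩) (fun ⟨i, hi⟩ => ?_)
      ((iIndepFun_iff_iIndep ..).1 N.init_indep)
    cases i <;> cases hi
    exact ⟨_, rfl⟩
  · refine iIndep.of_precomp (g := fun i : ℕ × ℕ => ⟨.arrival i.1 i.2, rfl⟩) (fun ⟨i, hi⟩ => ?_)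
      ((iIndepFun_iff_iIndep ..).1 N.arrival_indep)
    cases i <;> cases hi
    exact ⟨(_, _), rfl⟩
  · refine iIndep.of_precomp (g := fun i : ℕ × ℕ => ⟨.coin i.1 i.2, rfl⟩) (fun ⟨i, hi⟩ => ?_)
      ((iIndepFun_iff_iIndep ..).1 N.coin_indep)
    cases i <;> cases hi
    exact ⟨(_, _), rfl⟩

lemma iIndep_sourceAlgebra [IsProbabilityMeasure P] : iIndep N.sourceAlgebra P :=
  iIndep_of_iIndep_fibers Source.kind N.indep N.sourceAlgebra_le_generated
    N.iIndep_sourceAlgebra_of_kind_eq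

lemma known_le (S : Set Source) : N.known S ≤ ‹MeasurableSpace Ω› :=
  iSup₂_le fun i _ => N.sourceAlgebra_le i

lemma known_mono (h : S ⊆ T) : N.known S ≤ N.known T := biSup_mono h

lemma iIndep_known [IsProbabilityMeasure P] {κ : Type*} {S : κ → Set Source}
    (hS : Pairwise fun k l => Disjoint (S k) (S l)) : iIndep (fun k => N.known (S k)) P :=
  iIndep_biSup_of_pairwise_disjoint N.sourceAlgebra_le N.iIndep_sourceAlgebra hS

lemma indep_known [IsProbabilityMeasure P] (h : Disjoint S T) :
    Indep (N.known S) (N.known T) P :=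
  indep_iSup_of_disjoint N.sourceAlgebra_le N.iIndep_sourceAlgebra h

lemma measure_inter_of_disjoint [IsProbabilityMeasure P] (h : Disjoint S T) {B C : Set Ω}
    (hB : MeasurableSet[N.known S] B) (hC : MeasurableSet[N.known T] C) :
    P (B ∩ C) = P B * P C :=
  (Indep_iff _ _ P).1 (N.indep_known h) B C hB hC

lemma lintegral_comp_of_disjoint [IsProbabilityMeasure P] (h : Disjoint S T)
    {β γ : Type*} [MeasurableSpace β] [MeasurableSpace γ] {L : Ω → β} {Z : Ω → γ}
    (hL : Measurable[N.known S] L) (hZ : Measurable[N.known T] Z) {φ : β → γ → ℝ≥0∞}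
    (hφ : Measurable (Function.uncurry φ)) :
    ∫⁻ ω, φ (L ω) (Z ω) ∂P = ∫⁻ ω, ∫⁻ ω', φ (L ω) (Z ω') ∂P ∂P :=
  lintegral_comp_of_indepFun
    (indep_of_indep_of_le_left (indep_of_indep_of_le_right (N.indep_known h) hZ.comap_le)
      hL.comap_le)
    (hL.mono (N.known_le S) le_rfl) (hZ.mono (N.known_le T) le_rfl) hφ

lemma setLIntegral_of_disjoint [IsProbabilityMeasure P] (h : Disjoint S T) {B : Set Ω}
    (hB : MeasurableSet[N.known S] B) {f : Ω → ℝ≥0∞} (hf : Measurable[N.known T] f) :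
    ∫⁻ ω in B, f ω ∂P = P B * ∫⁻ ω, f ω ∂P := by
  have hB' : MeasurableSet B := N.known_le S B hB
  have hindicator : Measurable[N.known S] (B.indicator (1 : Ω → ℝ≥0∞)) :=
    measurable_const.indicator hB
  calc ∫⁻ ω in B, f ω ∂P
    _ = ∫⁻ ω, B.indicator 1 ω * f ω ∂P := by
      rw [← lintegral_indicator hB']
      exact lintegral_congr fun ω => by by_cases h : ω ∈ B <;> simp [h]
    _ = P B * ∫⁻ ω, f ω ∂P := by
      rw [lintegral_mul_eq_lintegral_mul_lintegral_of_independent_measurableSpace (N.known_le S)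
        (N.known_le T) (N.indep_known h) hindicator hf,
        lintegral_indicator_one hB']

lemma sourceAlgebra_le_known {i : Source} (h : i ∈ S) : N.sourceAlgebra i ≤ N.known S :=
  le_iSup₂_of_le i h le_rfl

lemma measurable_loc (h : Source.loc ∈ S) (m : ℕ) : Measurable[N.known S] (N.loc m) :=
  measurable_iff_comap_le.2 ((le_iSup (fun i => MeasurableSpace.comap (N.loc i) _) m).trans
    (N.sourceAlgebra_le_known h))

lemma measurable_dir (h : Source.dir ∈ S) (m : ℕ) : Measurable[N.known S] (N.dir m) :=
  measurable_iff_comap_le.2 ((le_iSup (fun i => MeasurableSpace.comap (N.dir i) _) m).trans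
    (N.sourceAlgebra_le_known h))

lemma measurable_fade {m s : ℕ} (h : Source.fade m s ∈ S) : Measurable[N.known S] (N.fade m s) :=
  measurable_iff_comap_le.2 (N.sourceAlgebra_le_known h)

lemma measurable_init {m : ℕ} (h : Source.init m ∈ S) : Measurable[N.known S] (N.init m) :=
  measurable_iff_comap_le.2 (N.sourceAlgebra_le_known h)

lemma measurable_arrival {m t : ℕ} (h : Source.arrival m t ∈ S) :
    Measurable[N.known S] (N.arrival m t) :=
  measurable_iff_comap_le.2 (N.sourceAlgebra_le_known h)

lemma measurable_coin {m t : ℕ} (h : Source.coin m t ∈ S) : Measurable[N.known S] (N.coin m t) :=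
  measurable_iff_comap_le.2 (N.sourceAlgebra_le_known h)

variable {q : ℝ}

/-- The sources that determine the energy of the transmitter `m` at time `t`. -/
def energySources (m t : ℕ) : Set Source :=
  {i | i = .init m ∨ ∃ s < t, i = .arrival m s ∨ i = .coin m s}

lemma monotone_energySources (m : ℕ) : Monotone (energySources m) := by
  rintro a b hab i (h | ⟨s, hs, h⟩)
  · exact Or.inl h
  · exact Or.inr ⟨s, hs.trans_le hab, h⟩

lemma measurable_energyUpdate (q : ℝ) : Measurable fun x : ℕ × ℕ × ℝ =>
    x.1 + x.2.1 - if 1 ≤ x.1 ∧ x.2.2 < q then 1 else 0 :=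
  (measurable_fst.add measurable_snd.fst).sub <| Measurable.ite
    ((measurableSet_le measurable_const measurable_fst).inter
      (measurableSet_lt measurable_snd.snd measurable_const)) measurable_const measurable_const

lemma measurable_energy (q : ℝ) (m t : ℕ) :
    Measurable[N.known (energySources m t)] (N.energy q m t) := by
  induction t with
  | zero => exact N.measurable_init (Or.inl rfl)
  | succ t ih =>
    have henergy : Measurable[N.known (energySources m (t + 1))] (N.energy q m t) :=
      ih.mono (N.known_mono (monotone_energySources m t.le_succ)) le_rfl
    have harrival : Measurable[N.known (energySources m (t + 1))] (N.arrival m t) :=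
      N.measurable_arrival (Or.inr ⟨t, t.lt_succ_self, Or.inl rfl⟩)
    have hcoin : Measurable[N.known (energySources m (t + 1))] (N.coin m t) :=
      N.measurable_coin (Or.inr ⟨t, t.lt_succ_self, Or.inr rfl⟩)
    exact (measurable_energyUpdate q).comp (henergy.prodMk (harrival.prodMk hcoin))

lemma measurableSet_setOf_one_le_energy (q : ℝ) (m t : ℕ) :
    MeasurableSet {ω | 1 ≤ N.energy q m t ω} :=
  N.known_le _ _ (N.measurable_energy q m t measurableSet_Ici)

lemma lintegral_comp_arrival [IsProbabilityMeasure P] (hp : p ∈ Set.Icc 0 1) (m t : ℕ)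
    (f : ℕ → ℝ≥0∞) :
    ∫⁻ ω, f (N.arrival m t ω) ∂P = ENNReal.ofReal (1 - p) * f 0 + ENNReal.ofReal p * f 1 := by
  have h0 : MeasurableSet {ω | N.arrival m t ω = 0} :=
    N.arrival_measurable m t (measurableSet_singleton 0)
  have h1 : MeasurableSet {ω | N.arrival m t ω = 1} :=
    N.arrival_measurable m t (measurableSet_singleton 1)
  have hae : ∀ᵐ ω ∂P, N.arrival m t ω = 0 ∨ N.arrival m t ω = 1 := by
    have hdisj : Disjoint {ω | N.arrival m t ω = 0} {ω | N.arrival m t ω = 1} :=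
      Set.disjoint_left.2 fun ω h h' => zero_ne_one (h.symm.trans h')
    refine (prob_compl_eq_zero_iff (h0.union h1)).2 ?_
    rw [measure_union hdisj h1, N.arrival_zero, N.arrival_one,
      ← ENNReal.ofReal_add (sub_nonneg.2 hp.2) hp.1, sub_add_cancel, ENNReal.ofReal_one]
  calc ∫⁻ ω, f (N.arrival m t ω) ∂P
    _ = ∫⁻ ω, ({ω | N.arrival m t ω = 0}.indicator (fun _ => f 0) ω +
        {ω | N.arrival m t ω = 1}.indicator (fun _ => f 1) ω) ∂P := by
      refine lintegral_congr_ae ?_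
      filter_upwards [hae] with ω hω
      rcases hω with h | h <;> simp [h]
    _ = ENNReal.ofReal (1 - p) * f 0 + ENNReal.ofReal p * f 1 := by
      rw [lintegral_add_left (measurable_const.indicator h0), lintegral_indicator_const h0,
        lintegral_indicator_const h1, N.arrival_zero, N.arrival_one, mul_comm, mul_comm (f 1)]

lemma lintegral_comp_add_arrival [IsProbabilityMeasure P] (hp : p ∈ Set.Icc 0 1) (m t e : ℕ)
    {f : ℕ → ℝ} (hf : ∀ e, 0 ≤ f e) :
    ∫⁻ ω, ENNReal.ofReal (f (e + N.arrival m t ω)) ∂P =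
      ENNReal.ofReal ((1 - p) * f e + p * f (e + 1)) := by
  have hp' : 0 ≤ 1 - p := sub_nonneg.2 hp.2
  rw [N.lintegral_comp_arrival hp m t fun a => ENNReal.ofReal (f (e + a)),
    ENNReal.ofReal_add (mul_nonneg hp' (hf _)) (mul_nonneg hp.1 (hf _)), ENNReal.ofReal_mul hp',
    ENNReal.ofReal_mul hp.1, add_zero]

lemma measure_coin_lt (hq : q ≤ 1) (m t : ℕ) : P {ω | N.coin m t ω < q} = ENNReal.ofReal q := by
  have hinter : Set.Iio q ∩ Set.Icc 0 1 = Set.Ico 0 q := by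
    ext x
    exact ⟨fun h => ⟨h.2.1, h.1⟩, fun h => ⟨h.2, h.1, h.2.le.trans hq⟩⟩
  calc P {ω | N.coin m t ω < q}
    _ = P.map (N.coin m t) (Set.Iio q) :=
      (Measure.map_apply (N.coin_measurable m t) measurableSet_Iio).symm
    _ = ENNReal.ofReal q := by
      rw [N.coin_law, Measure.restrict_apply measurableSet_Iio, hinter, Real.volume_Ico, sub_zero]

lemma lintegral_coin_lt [IsProbabilityMeasure P] (hq : q ∈ Set.Icc 0 1) (m t : ℕ)
    (a b : ℝ≥0∞) : ∫⁻ ω, (if N.coin m t ω < q then a else b) ∂P =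
      ENNReal.ofReal q * a + ENNReal.ofReal (1 - q) * b := by
  have h : MeasurableSet {ω | N.coin m t ω < q} :=
    measurableSet_lt (N.coin_measurable m t) measurable_const
  calc ∫⁻ ω, (if N.coin m t ω < q then a else b) ∂P
    _ = ∫⁻ ω, ({ω | N.coin m t ω < q}.indicator (fun _ => a) ω +
        {ω | N.coin m t ω < q}ᶜ.indicator (fun _ => b) ω) ∂P :=
      lintegral_congr fun ω => by by_cases hω : N.coin m t ω < q <;> simp [hω]
    _ = ENNReal.ofReal q * a + ENNReal.ofReal (1 - q) * b := by
      rw [lintegral_add_left (measurable_const.indicator h), lintegral_indicator_const h,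
        lintegral_indicator_const h.compl, prob_compl_eq_one_sub h, N.measure_coin_lt hq.2,
        ← ENNReal.ofReal_one, ← ENNReal.ofReal_sub _ hq.1, mul_comm, mul_comm b]

lemma lintegral_comp_energyUpdate [IsProbabilityMeasure P] (hp : p ∈ Set.Icc 0 1)
    (hq : q ∈ Set.Icc 0 1) (m t e : ℕ) {f : ℕ → ℝ} (hf : ∀ e, 0 ≤ f e) :
    ∫⁻ ω, ENNReal.ofReal (f (e + N.arrival m t ω -
      if 1 ≤ e ∧ N.coin m t ω < q then 1 else 0)) ∂P = ENNReal.ofReal (batteryStep p q f e) := by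
  rcases e with _ | e
  · simpa using N.lintegral_comp_add_arrival hp m t 0 hf
  have hp' : 0 ≤ 1 - p := sub_nonneg.2 hp.2
  have hq' : 0 ≤ 1 - q := sub_nonneg.2 hq.2
  have hmean (k : ℕ) : 0 ≤ (1 - p) * f k + p * f (k + 1) :=
    add_nonneg (mul_nonneg hp' (hf _)) (mul_nonneg hp.1 (hf _))
  have hφ : Measurable (Function.uncurry fun (c : ℝ) (a : ℕ) =>
      if c < q then ENNReal.ofReal (f (e + a)) else ENNReal.ofReal (f (e + 1 + a))) :=
    Measurable.ite (measurableSet_lt measurable_fst measurable_const)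
      ((measurable_from_top (f := fun a => ENNReal.ofReal (f (e + a)))).comp measurable_snd)
      ((measurable_from_top (f := fun a => ENNReal.ofReal (f (e + 1 + a)))).comp measurable_snd)
  calc ∫⁻ ω, ENNReal.ofReal (f (e + 1 + N.arrival m t ω -
        if 1 ≤ e + 1 ∧ N.coin m t ω < q then 1 else 0)) ∂P
    _ = ∫⁻ ω, (if N.coin m t ω < q then ENNReal.ofReal (f (e + N.arrival m t ω))
        else ENNReal.ofReal (f (e + 1 + N.arrival m t ω))) ∂P := by
      refine lintegral_congr fun ω => ?_
      by_cases hc : N.coin m t ω < q <;> simp [hc, Nat.add_right_comm e 1]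
    _ = ∫⁻ ω, (if N.coin m t ω < q then ENNReal.ofReal ((1 - p) * f e + p * f (e + 1))
        else ENNReal.ofReal ((1 - p) * f (e + 1) + p * f (e + 2))) ∂P := by
      rw [N.lintegral_comp_of_disjoint (S := {.coin m t}) (T := {.arrival m t}) (by simp)
        (N.measurable_coin rfl) (N.measurable_arrival rfl) hφ]
      refine lintegral_congr fun ω => ?_
      split_ifs
      exacts [N.lintegral_comp_add_arrival hp m t e hf,
        N.lintegral_comp_add_arrival hp m t (e + 1) hf]
    _ = ENNReal.ofReal (batteryStep p q f (e + 1)) := by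
      rw [N.lintegral_coin_lt hq, ← ENNReal.ofReal_mul hq.1, ← ENNReal.ofReal_mul hq',
        ← ENNReal.ofReal_add (mul_nonneg hq.1 (hmean e)) (mul_nonneg hq' (hmean (e + 1))),
        batteryStep.apply_succ]
      ring_nf

lemma lintegral_comp_energy [IsProbabilityMeasure P] (hp : p ∈ Set.Icc 0 1)
    (hq : q ∈ Set.Icc 0 1) (m t : ℕ) {f : ℕ → ℝ} (hf : ∀ e, 0 ≤ f e) :
    ∫⁻ ω, ENNReal.ofReal (f (N.energy q m t ω)) ∂P =
      ∫⁻ ω, ENNReal.ofReal ((batteryStep p q ^ t) f (N.init m ω)) ∂P := by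
  induction t generalizing f with
  | zero => rfl
  | succ t ih =>
    have hdisj : Disjoint (energySources m t) {.arrival m t, .coin m t} := by
      refine Set.disjoint_left.2 ?_
      rintro i (rfl | ⟨s, hs, rfl | rfl⟩) (h | h) <;> simp_all
    have hZ : Measurable[N.known {.arrival m t, .coin m t}]
        fun ω => (N.arrival m t ω, N.coin m t ω) :=
      (N.measurable_arrival (by simp)).prodMk (N.measurable_coin (by simp))
    have hφ : Measurable (Function.uncurry fun (e : ℕ) (z : ℕ × ℝ) =>
        ENNReal.ofReal (f (e + z.1 - if 1 ≤ e ∧ z.2 < q then 1 else 0))) :=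
      (measurable_from_top (f := fun k => ENNReal.ofReal (f k))).comp (measurable_energyUpdate q)
    calc ∫⁻ ω, ENNReal.ofReal (f (N.energy q m (t + 1) ω)) ∂P
      _ = ∫⁻ ω, ENNReal.ofReal (batteryStep p q f (N.energy q m t ω)) ∂P :=
        (N.lintegral_comp_of_disjoint hdisj (N.measurable_energy q m t) hZ hφ).trans
          (lintegral_congr fun ω => N.lintegral_comp_energyUpdate hp hq m t _ hf)
      _ = ∫⁻ ω, ENNReal.ofReal ((batteryStep p q ^ (t + 1)) f (N.init m ω)) ∂P := by
        rw [pow_succ]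
        exact ih fun e => by simpa using batteryStep.pow_apply_nonneg hp hq hf 1 e

/-- The probability that a transmitter with access probability `q` has energy at time `t`,
expressed through the battery chain. -/
noncomputable def nonemptyProb (q : ℝ) (t : ℕ) : ℝ≥0∞ :=
  ∫⁻ ω, ENNReal.ofReal ((batteryStep p q ^ t) ((Set.Ici 1).indicator 1) (N.init 0 ω)) ∂P

lemma measure_setOf_one_le_energy [IsProbabilityMeasure P] (hp : p ∈ Set.Icc 0 1)
    (hq : q ∈ Set.Icc 0 1) (m t : ℕ) : P {ω | 1 ≤ N.energy q m t ω} = N.nonemptyProb q t := by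
  let tail : ℕ → ℝ := (Set.Ici 1).indicator 1
  calc P {ω | 1 ≤ N.energy q m t ω}
    _ = ∫⁻ ω, ENNReal.ofReal (tail (N.energy q m t ω)) ∂P := by
      rw [← lintegral_indicator_one (N.measurableSet_setOf_one_le_energy q m t)]
      refine lintegral_congr fun ω => ?_
      by_cases h : 1 ≤ N.energy q m t ω <;> simp [tail, Set.indicator, h]
    _ = ∫⁻ ω, ENNReal.ofReal ((batteryStep p q ^ t) tail (N.init m ω)) ∂P :=
      N.lintegral_comp_energy hp hq m t (Set.indicator_nonneg fun _ _ => zero_le_one)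
    _ = N.nonemptyProb q t := ((N.init_law m).comp (u := fun e => ENNReal.ofReal
        ((batteryStep p q ^ t) tail e)) measurable_from_top).lintegral_eq

lemma tendsto_nonemptyProb [IsProbabilityMeasure P] (hp : p ∈ Set.Icc 0 1) (hp0 : 0 < p)
    (hq : q ∈ Set.Icc 0 1) :
    Tendsto (N.nonemptyProb q) atTop (𝓝 (ENNReal.ofReal (if q ≤ p then 1 else p / q))) := by
  have h : Tendsto (N.nonemptyProb q) atTop
      (𝓝 (∫⁻ _, ENNReal.ofReal (if q ≤ p then 1 else p / q) ∂P)) := by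
    refine tendsto_lintegral_of_dominated_convergence (fun _ => 1) (fun t => ?_)
      (fun t => ae_of_all _ fun ω => ?_) (by simp) (ae_of_all _ fun ω => ?_)
    · exact (measurable_from_top (f := fun e => ENNReal.ofReal
        ((batteryStep p q ^ t) ((Set.Ici 1).indicator 1) e))).comp (N.init_measurable 0)
    · exact ENNReal.ofReal_le_one.2
        (batteryStep.pow_apply_le_one hp hq (batteryStep.indicator_Ici_le_one 1) t _)
    · exact ENNReal.tendsto_ofReal
        (batteryStep.tendsto_pow_apply_indicator_Ici_one hp hp0 hq _)
  simpa using h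

/-- The probability that a transmitter with access probability `q` transmits at time `t`. -/
noncomputable def transmitProb (q : ℝ) (t : ℕ) : ℝ≥0∞ := ENNReal.ofReal q * N.nonemptyProb q t

/-- The sources that determine whether the transmitter `m` transmits at time `t`. -/
def transmitSources (m t : ℕ) : Set Source := insert (.coin m t) (energySources m t)

lemma measurableSet_setOf_transmits (q : ℝ) (m t : ℕ) :
    MeasurableSet[N.known (transmitSources m t)] {ω | N.Transmits q m t ω} :=
  .inter (((N.measurable_energy q m t).mono (N.known_mono (Set.subset_insert _ _)) le_rfl)
    measurableSet_Ici) (N.measurable_coin (Set.mem_insert _ _) measurableSet_Iio)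

lemma measure_setOf_transmits [IsProbabilityMeasure P] (hp : p ∈ Set.Icc 0 1)
    (hq : q ∈ Set.Icc 0 1) (m t : ℕ) : P {ω | N.Transmits q m t ω} = N.transmitProb q t := by
  have hdisj : Disjoint (energySources m t) {.coin m t} := by
    refine Set.disjoint_left.2 ?_
    rintro i (rfl | ⟨s, hs, rfl | rfl⟩) h <;> simp_all
  calc P {ω | N.Transmits q m t ω}
    _ = P {ω | 1 ≤ N.energy q m t ω} * P {ω | N.coin m t ω < q} :=
      N.measure_inter_of_disjoint hdisj (N.measurable_energy q m t measurableSet_Ici)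
        (N.measurable_coin (Set.mem_singleton _) measurableSet_Iio)
    _ = N.transmitProb q t := by
      rw [N.measure_setOf_one_le_energy hp hq, N.measure_coin_lt hq.2, mul_comm, transmitProb]

lemma transmitProb_le_one [IsProbabilityMeasure P] (hp : p ∈ Set.Icc 0 1)
    (hq : q ∈ Set.Icc 0 1) (t : ℕ) : N.transmitProb q t ≤ 1 :=
  (N.measure_setOf_transmits hp hq 0 t).symm.trans_le prob_le_one

lemma tendsto_transmitProb [IsProbabilityMeasure P] (hp : p ∈ Set.Icc 0 1) (hp0 : 0 < p)
    (hq : q ∈ Set.Icc 0 1) :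
    Tendsto (N.transmitProb q) atTop (𝓝 (ENNReal.ofReal (min q p))) := by
  have hlim : ENNReal.ofReal (min q p) =
      ENNReal.ofReal q * ENNReal.ofReal (if q ≤ p then 1 else p / q) := by
    rw [← ENNReal.ofReal_mul hq.1]
    split_ifs with hqp
    · rw [min_eq_left hqp, mul_one]
    · have hpq := not_le.1 hqp
      rw [min_eq_right hpq.le, mul_div_cancel₀ _ (hp0.trans hpq).ne']
  rw [hlim]
  exact ENNReal.Tendsto.const_mul (N.tendsto_nonemptyProb hp hp0 hq) (.inr ENNReal.ofReal_ne_top)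

end HarvestingNetwork

/-! ### Success of a transmission -/

/-- The probability that an interferer, transmitting with probability `τ`, does not destroy a
signal, when its unit mean exponential fading power is multiplied by `a`, in units in which the
fading power of the signal has unit mean. -/
noncomputable def harmlessProb (τ a : ℝ≥0∞) : ℝ≥0∞ := 1 - τ + τ * (1 + a)⁻¹

lemma harmlessProb_zero {τ : ℝ≥0∞} (hτ : τ ≤ 1) : harmlessProb τ 0 = 1 := by
  simp [harmlessProb, tsub_add_cancel_of_le hτ]

lemma harmlessProb_le_one {τ : ℝ≥0∞} (hτ : τ ≤ 1) (a : ℝ≥0∞) : harmlessProb τ a ≤ 1 := by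
  rw [← harmlessProb_zero hτ, harmlessProb, harmlessProb]
  gcongr
  exact zero_le

lemma one_sub_harmlessProb {τ : ℝ≥0∞} (hτ : τ ≤ 1) (a : ℝ≥0∞) :
    1 - harmlessProb τ a = τ * (1 - (1 + a)⁻¹) := by
  have hinv : (1 + a)⁻¹ ≤ 1 := ENNReal.inv_le_one.2 le_self_add
  refine ENNReal.sub_eq_of_eq_add ((harmlessProb_le_one hτ a).trans_lt ENNReal.one_lt_top).ne ?_
  calc 1 = 1 - τ + τ * (1 - (1 + a)⁻¹ + (1 + a)⁻¹) := by
        rw [tsub_add_cancel_of_le hinv, mul_one, tsub_add_cancel_of_le hτ]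
    _ = τ * (1 - (1 + a)⁻¹) + harmlessProb τ a := by rw [harmlessProb]; ring

lemma measurable_harmlessProb (τ : ℝ≥0∞) : Measurable (harmlessProb τ) := by
  unfold harmlessProb
  fun_prop

/-- The path loss from `z` to the receiver of a transmitter at `x` with orientation `u`, relative
to the path loss of the signal and multiplied by the threshold `θ`. -/
noncomputable def relativeGain (d α θ : ℝ) (u : Metric.sphere (0 : Plane) 1) (x z : Plane) :
    ℝ≥0∞ :=
  ENNReal.ofReal (θ * d ^ α) * edist z (x + d • (u : Plane)) ^ (-α)

@[fun_prop]
lemma measurable_relativeGain {β : Type*} {_ : MeasurableSpace β} (d α θ : ℝ)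
    {u : β → Metric.sphere (0 : Plane) 1} {x z : β → Plane} (hu : Measurable u)
    (hx : Measurable x) (hz : Measurable z) :
    Measurable fun b => relativeGain d α θ (u b) (x b) (z b) :=
  ((hz.edist (hx.add (hu.subtype_val.const_smul d))).pow_const _).const_mul _

/-- The contribution of an interferer at `z`, transmitting with probability `τ`, to `-log` of the
success probability of a transmitter at `x` with orientation `u`. -/
noncomputable def interfererCost (d α θ : ℝ) (τ : ℝ≥0∞) (u : Metric.sphere (0 : Plane) 1)
    (x z : Plane) : ℝ≥0∞ :=
  negLog (harmlessProb τ (relativeGain d α θ u x z))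

@[fun_prop]
lemma measurable_interfererCost {β : Type*} {_ : MeasurableSpace β} (d α θ : ℝ) (τ : ℝ≥0∞)
    {u : β → Metric.sphere (0 : Plane) 1} {x z : β → Plane} (hu : Measurable u)
    (hx : Measurable x) (hz : Measurable z) :
    Measurable fun b => interfererCost d α θ τ (u b) (x b) (z b) :=
  measurable_negLog.comp ((measurable_harmlessProb τ).comp
    (measurable_relativeGain d α θ hu hx hz))

lemma lamMax_pos {d α θ : ℝ} (hd : 0 < d) (hα : 2 < α) (hθ : 0 < θ) : 0 < lamMax d α θ := by
  have hsin := sin_two_mul_pi_div_pos hα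
  unfold lamMax pathLossConst
  positivity

lemma lintegral_one_sub_negExp_interfererCost {d α θ : ℝ} (hd : 0 < d) (hα : 2 < α) (hθ : 0 < θ)
    {τ : ℝ≥0∞} (hτ : τ ≤ 1) (u : Metric.sphere (0 : Plane) 1) (x : Plane) :
    ∫⁻ z, (1 - negExp (interfererCost d α θ τ u x z)) =
      τ * ENNReal.ofReal (1 / lamMax d α θ) := by
  have hscale : (θ * d ^ α) ^ (2 / α) * pathLossConst α = 1 / lamMax d α θ := by
    rw [lamMax, one_div_one_div, Real.mul_rpow hθ.le (by positivity), ← Real.rpow_mul hd.le,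
      mul_div_cancel₀ _ (by positivity), Real.rpow_two, mul_comm (θ ^ _)]
  calc ∫⁻ z, (1 - negExp (interfererCost d α θ τ u x z))
    _ = ∫⁻ z, τ * (1 - (1 + ENNReal.ofReal (θ * d ^ α) *
        ‖z - (x + d • (u : Plane))‖ₑ ^ (-α))⁻¹) := by
      refine lintegral_congr fun z => ?_
      rw [interfererCost, negExp_negLog (harmlessProb_le_one hτ _), one_sub_harmlessProb hτ,
        relativeGain, edist_eq_enorm_sub]
    _ = τ * ∫⁻ z : Plane, (1 - (1 + ENNReal.ofReal (θ * d ^ α) * ‖z‖ₑ ^ (-α))⁻¹) := by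
      rw [lintegral_const_mul' _ _ (hτ.trans_lt ENNReal.one_lt_top).ne,
        lintegral_sub_right_eq_self
          (fun z : Plane => 1 - (1 + ENNReal.ofReal (θ * d ^ α) * ‖z‖ₑ ^ (-α))⁻¹)]
    _ = τ * ENNReal.ofReal (1 / lamMax d α θ) := by
      rw [lintegral_plane_one_sub_inv_one_add hα (by positivity), hscale]

namespace HarvestingNetwork

variable {Ω : Type*} [MeasurableSpace Ω] {P : Measure Ω} {lam p σ q : ℝ}
  (N : HarvestingNetwork P lam p σ)

lemma lintegral_comp_norm_fade (n s : ℕ) {f : ℝ → ℝ≥0∞} (hf : Measurable f) :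
    ∫⁻ ω, f ‖N.fade n s ω‖ ∂P = ∫⁻ x, f x ∂rayleighMeasure σ := by
  rw [← N.fade_law n s, lintegral_map hf (N.fade_measurable n s).norm]

lemma measure_inter_setOf_lt_mul_fade [IsProbabilityMeasure P] (hσ : 0 < σ) {b : ℝ} (hb : 0 < b)
    (n s : ℕ) {B : Set Ω} (hB : MeasurableSet[N.known {.fade n s}ᶜ] B) {I : Ω → ℝ≥0∞}
    (hI : Measurable[N.known {.fade n s}ᶜ] I) :
    P (B ∩ {ω | I ω < ENNReal.ofReal b * ‖N.fade n s ω‖ₑ ^ 2}) =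
      ∫⁻ ω in B, negExp (ENNReal.ofReal (1 / (b * (2 * σ ^ 2))) * I ω) ∂P := by
  let E : Set (ℝ≥0∞ × ℝ) := {y | y.1 < ENNReal.ofReal b * ENNReal.ofReal y.2 ^ 2}
  have hE : MeasurableSet E := measurableSet_lt (by fun_prop) (by fun_prop)
  have hB' : MeasurableSet B := N.known_le _ _ hB
  have hevent : MeasurableSet {ω | I ω < ENNReal.ofReal b * ‖N.fade n s ω‖ₑ ^ 2} :=
    measurableSet_lt (hI.mono (N.known_le _) le_rfl)
      (((N.fade_measurable n s).enorm.pow_const 2).const_mul _)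
  have hindicator : Measurable[N.known {.fade n s}ᶜ] (B.indicator (1 : Ω → ℝ≥0∞)) :=
    measurable_const.indicator hB
  have hsection (i : ℝ≥0∞) : ∫⁻ ω, E.indicator 1 (i, ‖N.fade n s ω‖) ∂P =
      negExp (ENNReal.ofReal (1 / (b * (2 * σ ^ 2))) * i) :=
    calc ∫⁻ ω, E.indicator 1 (i, ‖N.fade n s ω‖) ∂P
      _ = ∫⁻ x, (Prod.mk i ⁻¹' E).indicator 1 x ∂rayleighMeasure σ :=
        N.lintegral_comp_norm_fade n s (measurable_one.indicator (measurable_prodMk_left hE))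
      _ = rayleighMeasure σ (Prod.mk i ⁻¹' E) :=
        lintegral_indicator_one (measurable_prodMk_left hE)
      _ = negExp (ENNReal.ofReal (1 / (b * (2 * σ ^ 2))) * i) :=
        rayleighMeasure_setOf_lt_mul_sq hσ hb i
  have hφ : Measurable (Function.uncurry fun (l : ℝ≥0∞ × ℝ≥0∞) (z : ℂ) =>
      l.1 * E.indicator (1 : ℝ≥0∞ × ℝ → ℝ≥0∞) (l.2, ‖z‖)) :=
    measurable_fst.fst.mul ((measurable_one.indicator hE).comp
      (measurable_fst.snd.prodMk measurable_snd.norm))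
  calc P (B ∩ {ω | I ω < ENNReal.ofReal b * ‖N.fade n s ω‖ₑ ^ 2})
    _ = ∫⁻ ω, B.indicator 1 ω * E.indicator 1 (I ω, ‖N.fade n s ω‖) ∂P := by
      rw [← lintegral_indicator_one (hB'.inter hevent), Set.inter_indicator_one]
      refine lintegral_congr fun ω => ?_
      simp only [Pi.mul_apply, Set.indicator, E, Set.mem_ofPred_eq, ofReal_norm, Pi.one_apply]
    _ = ∫⁻ ω, ∫⁻ ω', B.indicator 1 ω * E.indicator 1 (I ω, ‖N.fade n s ω'‖) ∂P ∂P :=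
      N.lintegral_comp_of_disjoint (L := fun ω => (B.indicator 1 ω, I ω)) disjoint_compl_left
        (hindicator.prodMk hI) (N.measurable_fade rfl) hφ
    _ = ∫⁻ ω in B, negExp (ENNReal.ofReal (1 / (b * (2 * σ ^ 2))) * I ω) ∂P := by
      rw [← lintegral_indicator hB']
      refine lintegral_congr fun ω => ?_
      by_cases h : ω ∈ B <;> simp [h, hsection]

open Classical in
/-- The fading power from the transmitter `s`, with access probability `q`, to the receiver `n` if
`s` transmits at time `t`, and zero otherwise: the mark that `s` carries in the interference. -/
noncomputable def mark (q : ℝ) (n s t : ℕ) (ω : Ω) : ℝ≥0∞ :=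
  if N.Transmits q s t ω then ‖N.fade n s ω‖ₑ ^ 2 else 0

/-- The sources that determine the mark of the transmitter `s` at the receiver `n`. -/
def markSources (n s t : ℕ) : Set Source := insert (.fade n s) (transmitSources s t)

lemma pairwise_disjoint_markSources (n t : ℕ) :
    Pairwise fun r s => Disjoint (markSources n r t) (markSources n s t) := by
  refine fun r s hrs => Set.disjoint_left.2 ?_
  rintro i (rfl | rfl | rfl | ⟨u, -, rfl | rfl⟩) (h | h | h | ⟨v, -, h | h⟩) <;> simp_all

lemma markSources_subset_compl_loc_dir (n s t : ℕ) : markSources n s t ⊆ {.loc, .dir}ᶜ := by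
  rintro i (rfl | rfl | rfl | ⟨u, -, rfl | rfl⟩) <;> simp

lemma markSources_subset_compl_fade {n s : ℕ} (h : s ≠ n) (t : ℕ) :
    markSources n s t ⊆ {.fade n n}ᶜ := by
  rintro i (rfl | rfl | rfl | ⟨u, -, rfl | rfl⟩) <;> simp [h]

lemma measurable_mark (q : ℝ) (n s t : ℕ) :
    Measurable[N.known (markSources n s t)] (N.mark q n s t) := by
  have hsq : Measurable fun z : ℂ => ‖z‖ₑ ^ 2 := by fun_prop
  exact Measurable.ite
    (N.known_mono (Set.subset_insert _ _) _ (N.measurableSet_setOf_transmits q s t))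
    (hsq.comp (N.measurable_fade (Set.mem_insert _ _))) measurable_const

lemma iIndepFun_mark [IsProbabilityMeasure P] (q : ℝ) (n t : ℕ) :
    iIndepFun (fun s => N.mark q n s t) P :=
  (iIndepFun_iff_iIndep ..).2 <|
    iIndep_of_iIndep_of_le (N.iIndep_known (pairwise_disjoint_markSources n t)) fun s =>
      (N.measurable_mark q n s t).comap_le

lemma setLIntegral_transmits [IsProbabilityMeasure P] (hp : p ∈ Set.Icc 0 1)
    (hq : q ∈ Set.Icc 0 1) (n s t : ℕ) {f : ℝ → ℝ≥0∞} (hf : Measurable f) :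
    ∫⁻ ω in {ω | N.Transmits q s t ω}, f ‖N.fade n s ω‖ ∂P =
      N.transmitProb q t * ∫⁻ x, f x ∂rayleighMeasure σ := by
  have hdisj : Disjoint (transmitSources s t) {.fade n s} := by
    refine Set.disjoint_left.2 ?_
    rintro i (rfl | rfl | ⟨u, -, rfl | rfl⟩) <;> simp
  have hsource : Measurable[N.known {.fade n s}] fun ω => f ‖N.fade n s ω‖ :=
    (hf.comp measurable_norm).comp (N.measurable_fade rfl)
  rw [N.setLIntegral_of_disjoint hdisj (N.measurableSet_setOf_transmits q s t) hsource,
    N.measure_setOf_transmits hp hq, N.lintegral_comp_norm_fade n s hf]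

lemma lintegral_negExp_mark [IsProbabilityMeasure P] (hσ : 0 < σ) (hp : p ∈ Set.Icc 0 1)
    (hq : q ∈ Set.Icc 0 1) (n s t : ℕ) (a : ℝ≥0∞) :
    ∫⁻ ω, negExp (ENNReal.ofReal (1 / (2 * σ ^ 2)) * a * N.mark q n s t ω) ∂P =
      harmlessProb (N.transmitProb q t) a := by
  let T : Set Ω := {ω | N.Transmits q s t ω}
  have hT : MeasurableSet T := N.known_le _ _ (N.measurableSet_setOf_transmits q s t)
  let g : ℝ → ℝ≥0∞ := fun x =>
    negExp (ENNReal.ofReal (1 / (2 * σ ^ 2)) * a * ENNReal.ofReal x ^ 2)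
  have hg : Measurable g := measurable_negExp.comp (by fun_prop)
  calc ∫⁻ ω, negExp (ENNReal.ofReal (1 / (2 * σ ^ 2)) * a * N.mark q n s t ω) ∂P
    _ = ∫⁻ _ in Tᶜ, 1 ∂P + ∫⁻ ω in T, g ‖N.fade n s ω‖ ∂P := by
      rw [← lintegral_add_compl _ hT, add_comm]
      refine congrArg₂ _ (setLIntegral_congr_fun hT.compl fun ω hω => ?_)
        (setLIntegral_congr_fun hT fun ω hω => ?_)
      · simp only [mark, if_neg (show ¬ N.Transmits q s t ω from hω), mul_zero, negExp_zero]
      · simp only [mark, if_pos (show N.Transmits q s t ω from hω), g, ofReal_norm]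
    _ = harmlessProb (N.transmitProb q t) a := by
      rw [setLIntegral_one, prob_compl_eq_one_sub hT, N.measure_setOf_transmits hp hq,
        N.setLIntegral_transmits hp hq n s t hg, lintegral_negExp_mul_sq_rayleighMeasure hσ,
        harmlessProb]

lemma lintegral_negExp_tsum_mark [IsProbabilityMeasure P] (hσ : 0 < σ) (hp : p ∈ Set.Icc 0 1)
    (hq : q ∈ Set.Icc 0 1) (n t : ℕ) (a : ℕ → ℝ≥0∞) :
    ∫⁻ ω, negExp (∑' s, ENNReal.ofReal (1 / (2 * σ ^ 2)) * a s * N.mark q n s t ω) ∂P =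
      negExp (∑' s, negLog (harmlessProb (N.transmitProb q t) (a s))) := by
  have hmark (s : ℕ) : Measurable (N.mark q n s t) :=
    (N.measurable_mark q n s t).mono (N.known_le _) le_rfl
  rw [lintegral_negExp_tsum (fun s => (hmark s).const_mul _)
    ((N.iIndepFun_mark q n t).comp _ fun s => measurable_const_mul _)]
  simp_rw [N.lintegral_negExp_mark hσ hp hq]

variable {d α θ : ℝ} {A : Set Plane}

lemma interference_update (d α q q' : ℝ) (n t : ℕ) (ω : Ω) :
    N.interference d α (Function.update (fun _ => q') n q) n t ω = ∑' s, if s = n then 0 else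
      edist (N.loc s ω) (N.receiver d n ω) ^ (-α) * N.mark q' n s t ω := by
  refine tsum_congr fun s => ?_
  by_cases hs : s = n
  · simp [hs]
  · by_cases hT : N.Transmits q' s t ω <;> simp [hs, hT, mark]

lemma measurable_loc_seq {S : Set Source} (h : Source.loc ∈ S) :
    Measurable[N.known S] fun ω s => N.loc s ω :=
  @measurable_pi_lambda _ _ _ (N.known S) _ _ fun s => N.measurable_loc h s

lemma measurable_interference_update (d α q q' : ℝ) (n t : ℕ) :
    Measurable[N.known {.fade n n}ᶜ]
      (N.interference d α (Function.update (fun _ => q') n q) n t) := by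
  have hterm (s : ℕ) : Measurable[N.known {.fade n n}ᶜ] fun ω => if s = n then 0 else
      edist (N.loc s ω) (N.receiver d n ω) ^ (-α) * N.mark q' n s t ω := by
    split_ifs with hs
    · exact measurable_const
    have hgain : Measurable fun y : Plane × Plane × Metric.sphere (0 : Plane) 1 =>
        edist y.1 (y.2.1 + d • (y.2.2 : Plane)) ^ (-α) :=
      (Continuous.measurable (by fun_prop)).pow_const _
    have hsource : Measurable[N.known {.fade n n}ᶜ] fun ω => (N.loc s ω, N.loc n ω, N.dir n ω) :=
      (N.measurable_loc (by simp) s).prodMk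
        ((N.measurable_loc (by simp) n).prodMk (N.measurable_dir (by simp) n))
    have hmark : Measurable[N.known {.fade n n}ᶜ] (N.mark q' n s t) :=
      (N.measurable_mark q' n s t).mono (N.known_mono (markSources_subset_compl_fade hs t)) le_rfl
    exact (hgain.comp hsource).mul hmark
  have htsum : Measurable fun z : ℕ → ℝ≥0∞ => ∑' s, z s := .tsum measurable_pi_apply
  rw [funext (N.interference_update d α q q' n t)]
  exact htsum.comp (@measurable_pi_lambda _ _ _ (N.known _) _ _ hterm)

lemma lt_sir_iff (hθ : 0 < θ) (prof : ℕ → ℝ) (n t : ℕ) (ω : Ω) :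
    ENNReal.ofReal θ < N.sir d α prof n t ω ↔ ENNReal.ofReal θ * N.interference d α prof n t ω <
      ENNReal.ofReal (d ^ (-α)) * ‖N.fade n n ω‖ₑ ^ 2 :=
  ENNReal.lt_div_iff_mul_lt (.inr ENNReal.ofReal_ne_top) (.inr (by simpa using hθ))

lemma mul_interference_update (hd : 0 < d) (hθ : 0 < θ) (q q' : ℝ) (n t : ℕ) (ω : Ω) :
    ENNReal.ofReal (1 / (d ^ (-α) * (2 * σ ^ 2))) * (ENNReal.ofReal θ *
        N.interference d α (Function.update (fun _ => q') n q) n t ω) =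
      ∑' s, ENNReal.ofReal (1 / (2 * σ ^ 2)) *
        (if s = n then 0 else relativeGain d α θ (N.dir n ω) (N.loc n ω) (N.loc s ω)) *
        N.mark q' n s t ω := by
  have hscale : 1 / (d ^ (-α) * (2 * σ ^ 2)) * θ = 1 / (2 * σ ^ 2) * (θ * d ^ α) := by
    rw [Real.rpow_neg hd.le]
    field_simp
  rw [← mul_assoc, ← ENNReal.ofReal_mul (by positivity), hscale,
    ENNReal.ofReal_mul (by positivity), interference_update, ← ENNReal.tsum_mul_left]
  refine tsum_congr fun s => ?_
  split_ifs
  · simp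
  · rw [relativeGain, receiver]
    ring

lemma measure_inter_setOf_lt_sir [IsProbabilityMeasure P] (hσ : 0 < σ) (hd : 0 < d) (hθ : 0 < θ)
    (hA : MeasurableSet A) (q q' : ℝ) (n t : ℕ) :
    P ({ω | N.loc n ω ∈ A} ∩ {ω | ENNReal.ofReal θ <
        N.sir d α (Function.update (fun _ => q') n q) n t ω}) =
      ∫⁻ ω, A.indicator 1 (N.loc n ω) * negExp (∑' s, ENNReal.ofReal (1 / (2 * σ ^ 2)) *
        (if s = n then 0 else relativeGain d α θ (N.dir n ω) (N.loc n ω) (N.loc s ω)) *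
        N.mark q' n s t ω) ∂P := by
  have hloc : MeasurableSet[N.known {.fade n n}ᶜ] {ω | N.loc n ω ∈ A} :=
    N.measurable_loc (by simp) n hA
  have hinterference : Measurable[N.known {.fade n n}ᶜ] fun ω =>
      ENNReal.ofReal θ * N.interference d α (Function.update (fun _ => q') n q) n t ω :=
    (measurable_const_mul (ENNReal.ofReal θ)).comp (N.measurable_interference_update d α q q' n t)
  simp_rw [N.lt_sir_iff hθ]
  rw [N.measure_inter_setOf_lt_mul_fade hσ (by positivity) n n hloc hinterference,
    ← lintegral_indicator (N.known_le _ _ hloc)]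
  refine lintegral_congr fun ω => ?_
  rw [← N.mul_interference_update hd hθ q]
  by_cases h : N.loc n ω ∈ A <;> simp [h]

lemma lintegral_negExp_relativeGain [IsProbabilityMeasure P] (hσ : 0 < σ) (hp : p ∈ Set.Icc 0 1)
    (hq : q ∈ Set.Icc 0 1) (hA : MeasurableSet A) (d α θ : ℝ) (n t : ℕ) :
    ∫⁻ ω, A.indicator 1 (N.loc n ω) * negExp (∑' s, ENNReal.ofReal (1 / (2 * σ ^ 2)) *
        (if s = n then 0 else relativeGain d α θ (N.dir n ω) (N.loc n ω) (N.loc s ω)) *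
        N.mark q n s t ω) ∂P =
      ∫⁻ ω, A.indicator 1 (N.loc n ω) * negExp (∑' s, if s = n then 0 else
        interfererCost d α θ (N.transmitProb q t) (N.dir n ω) (N.loc n ω) (N.loc s ω)) ∂P := by
  let φ (l : Metric.sphere (0 : Plane) 1 × (ℕ → Plane)) (z : ℕ → ℝ≥0∞) : ℝ≥0∞ :=
    A.indicator 1 (l.2 n) * negExp (∑' s, ENNReal.ofReal (1 / (2 * σ ^ 2)) *
      (if s = n then 0 else relativeGain d α θ l.1 (l.2 n) (l.2 s)) * z s)
  have hgain (s : ℕ) : Measurable fun l : Metric.sphere (0 : Plane) 1 × (ℕ → Plane) =>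
      if s = n then 0 else relativeGain d α θ l.1 (l.2 n) (l.2 s) := by
    split_ifs <;> fun_prop
  have hφ : Measurable (Function.uncurry φ) :=
    ((measurable_one.indicator hA).comp (by fun_prop)).mul
      (measurable_negExp.comp (Measurable.tsum fun s =>
        (((hgain s).comp measurable_fst).const_mul _).mul (by fun_prop)))
  have hL : Measurable[N.known {.loc, .dir}] fun ω => (N.dir n ω, fun s => N.loc s ω) :=
    (N.measurable_dir (by simp) n).prodMk (N.measurable_loc_seq (by simp))
  have hZ : Measurable[N.known {.loc, .dir}ᶜ] fun ω s => N.mark q n s t ω :=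
    @measurable_pi_lambda _ _ _ (N.known _) _ _ fun s => (N.measurable_mark q n s t).mono
      (N.known_mono (markSources_subset_compl_loc_dir n s t)) le_rfl
  refine (N.lintegral_comp_of_disjoint disjoint_compl_right hL hZ hφ).trans
    (lintegral_congr fun ω => ?_)
  by_cases h : N.loc n ω ∈ A
  · simp only [φ, Set.indicator_of_mem h, Pi.one_apply, one_mul]
    rw [N.lintegral_negExp_tsum_mark hσ hp hq]
    congr 1
    refine tsum_congr fun s => ?_
    split_ifs
    · rw [harmlessProb_zero (N.transmitProb_le_one hp hq t), negLog_one]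
    · rfl
  · simp [φ, h]

lemma lintegral_comp_dir_loc [IsProbabilityMeasure P] (n : ℕ)
    {φ : Metric.sphere (0 : Plane) 1 → (ℕ → Plane) → ℝ≥0∞} (hφ : Measurable (Function.uncurry φ)) :
    ∫⁻ ω, φ (N.dir n ω) (fun s => N.loc s ω) ∂P =
      ∫⁻ ω, ∫⁻ ω', φ (N.dir 0 ω) (fun s => N.loc s ω') ∂P ∂P := by
  have hloc : Measurable[N.known {.loc}] fun ω s => N.loc s ω :=
    N.measurable_loc_seq (Set.mem_singleton _)
  have hmean : Measurable fun u => ∫⁻ ω', φ u (fun s => N.loc s ω') ∂P :=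
    Measurable.lintegral_prod_right' (f := fun y : _ × Ω => φ y.1 fun s => N.loc s y.2)
      (hφ.comp (measurable_fst.prodMk ((hloc.mono (N.known_le _) le_rfl).comp measurable_snd)))
  have hdir : Measurable[N.known {.dir}] (N.dir n) := N.measurable_dir (Set.mem_singleton _) n
  exact (N.lintegral_comp_of_disjoint (by simp) hdir hloc hφ).trans
    ((N.dir_law n).comp hmean).lintegral_eq

lemma tsum_lintegral_interfererCost [IsProbabilityMeasure P] (hd : 0 < d) (hα : 2 < α) (hθ : 0 < θ)
    {τ : ℝ≥0∞} (hτ : τ ≤ 1) (hA : MeasurableSet A) (u : Metric.sphere (0 : Plane) 1) :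
    ∑' n, ∫⁻ ω, A.indicator 1 (N.loc n ω) * negExp (∑' s, if s = n then 0 else
        interfererCost d α θ τ u (N.loc n ω) (N.loc s ω)) ∂P =
      negExp (ENNReal.ofReal lam * (τ * ENNReal.ofReal (1 / lamMax d α θ))) *
        (ENNReal.ofReal lam * volume A) := by
  have hcost : Measurable (Function.uncurry (interfererCost d α θ τ u)) :=
    measurable_interfererCost d α θ τ measurable_const measurable_fst measurable_snd
  rw [N.loc_poisson.tsum_lintegral_indicator_mul_negExp hA hcost]
  simp_rw [lintegral_smul_measure, lintegral_one_sub_negExp_interfererCost hd hα hθ hτ]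
  rw [setLIntegral_const, Measure.smul_apply, smul_eq_mul, smul_eq_mul]

lemma tsum_measure_inter_setOf_lt_sir [IsProbabilityMeasure P] (hσ : 0 < σ)
    (hp : p ∈ Set.Icc 0 1) (hd : 0 < d) (hα : 2 < α) (hθ : 0 < θ) (hA : MeasurableSet A) (q : ℝ)
    {q' : ℝ} (hq' : q' ∈ Set.Icc 0 1) (t : ℕ) :
    ∑' n, P ({ω | N.loc n ω ∈ A} ∩ {ω | ENNReal.ofReal θ <
        N.sir d α (Function.update (fun _ => q') n q) n t ω}) =
      negExp (ENNReal.ofReal lam * (N.transmitProb q' t * ENNReal.ofReal (1 / lamMax d α θ))) *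
        (ENNReal.ofReal lam * volume A) := by
  let φ (n : ℕ) (u : Metric.sphere (0 : Plane) 1) (x : ℕ → Plane) : ℝ≥0∞ :=
    A.indicator 1 (x n) * negExp (∑' s, if s = n then 0 else
      interfererCost d α θ (N.transmitProb q' t) u (x n) (x s))
  have hcost (n s : ℕ) : Measurable fun l : Metric.sphere (0 : Plane) 1 × (ℕ → Plane) =>
      if s = n then 0 else
        interfererCost d α θ (N.transmitProb q' t) l.1 (l.2 n) (l.2 s) := by
    split_ifs <;> fun_prop
  have hφ (n : ℕ) : Measurable (Function.uncurry (φ n)) :=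
    ((measurable_one.indicator hA).comp (by fun_prop)).mul
      (measurable_negExp.comp (Measurable.tsum (hcost n)))
  have hloc : Measurable fun y : Ω × Ω => (N.dir 0 y.1, fun s => N.loc s y.2) :=
    ((N.dir_measurable 0).comp measurable_fst).prodMk
      (measurable_pi_lambda _ fun s => (N.loc_poisson.measurable s).comp measurable_snd)
  calc ∑' n, P ({ω | N.loc n ω ∈ A} ∩ {ω | ENNReal.ofReal θ <
        N.sir d α (Function.update (fun _ => q') n q) n t ω})
    _ = ∑' n, ∫⁻ ω, ∫⁻ ω', φ n (N.dir 0 ω) (fun s => N.loc s ω') ∂P ∂P :=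
      tsum_congr fun n => by
        rw [N.measure_inter_setOf_lt_sir hσ hd hθ hA, N.lintegral_negExp_relativeGain hσ hp hq' hA]
        exact N.lintegral_comp_dir_loc n (hφ n)
    _ = ∫⁻ ω, ∑' n, ∫⁻ ω', φ n (N.dir 0 ω) (fun s => N.loc s ω') ∂P ∂P :=
      (lintegral_tsum fun n => (Measurable.lintegral_prod_right'
        (f := fun y : Ω × Ω => φ n (N.dir 0 y.1) fun s => N.loc s y.2)
        ((hφ n).comp hloc)).aemeasurable).symm
    _ = _ := by
      simp only [φ, N.tsum_lintegral_interfererCost hd hα hθ (N.transmitProb_le_one hp hq' t) hA,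
        lintegral_const, measure_univ, mul_one]

lemma typicalProb_eq [IsProbabilityMeasure P] (hlam : 0 < lam) (hA : MeasurableSet A)
    (hA0 : volume A ≠ 0) (hAtop : volume A ≠ ∞) {S : ℕ → Set Ω} {c : ℝ≥0∞}
    (h : ∑' n, P ({ω | N.loc n ω ∈ A} ∩ S n) = c * (ENNReal.ofReal lam * volume A)) :
    N.typicalProb A S = c.toReal := by
  have hmean : ∑' n, P {ω | N.loc n ω ∈ A} = ENNReal.ofReal lam * volume A :=
    N.loc_poisson.tsum_measure_preimage hA
  rw [typicalProb, h, hmean, ENNReal.mul_div_cancel_right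
    (mul_ne_zero (by simpa using hlam) hA0) (ENNReal.mul_ne_top ENNReal.ofReal_ne_top hAtop)]

lemma energyProbAt_eq [IsProbabilityMeasure P] (hlam : 0 < lam) (hp : p ∈ Set.Icc 0 1)
    (hA : MeasurableSet A) (hA0 : volume A ≠ 0) (hAtop : volume A ≠ ∞) (hq : q ∈ Set.Icc 0 1)
    (t : ℕ) : N.energyProbAt A q t = (N.nonemptyProb q t).toReal := by
  have hdisj (n : ℕ) : Disjoint {.loc} (energySources n t) :=
    Set.disjoint_singleton_left.2 (by rintro (h | ⟨s, -, h | h⟩) <;> cases h)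
  refine N.typicalProb_eq hlam hA hA0 hAtop ?_
  calc ∑' n, P ({ω | N.loc n ω ∈ A} ∩ {ω | 1 ≤ N.energy q n t ω})
    _ = ∑' n, P {ω | N.loc n ω ∈ A} * N.nonemptyProb q t := tsum_congr fun n => by
      rw [← N.measure_setOf_one_le_energy hp hq n t]
      exact N.measure_inter_of_disjoint (hdisj n) (N.measurable_loc (Set.mem_singleton _) n hA)
        (N.measurable_energy q n t measurableSet_Ici)
    _ = N.nonemptyProb q t * (ENNReal.ofReal lam * volume A) := by
      rw [ENNReal.tsum_mul_right, mul_comm]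
      exact congrArg _ (N.loc_poisson.tsum_measure_preimage hA)

lemma tendsto_energyProbAt [IsProbabilityMeasure P] (hlam : 0 < lam) (hp : p ∈ Set.Icc 0 1)
    (hp0 : 0 < p) (hA : MeasurableSet A) (hA0 : volume A ≠ 0) (hAtop : volume A ≠ ∞)
    (hq : q ∈ Set.Icc 0 1) :
    Tendsto (N.energyProbAt A q) atTop (𝓝 (if q ≤ p then 1 else p / q)) := by
  have hnonneg : 0 ≤ if q ≤ p then 1 else p / q := by
    have := hq.1
    positivity
  have hlim := (ENNReal.tendsto_toReal ENNReal.ofReal_ne_top).comp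
    (N.tendsto_nonemptyProb hp hp0 hq)
  rw [ENNReal.toReal_ofReal hnonneg] at hlim
  exact hlim.congr fun t => (N.energyProbAt_eq hlam hp hA hA0 hAtop hq t).symm

lemma tendsto_successProbAt [IsProbabilityMeasure P] (hlam : 0 < lam) (hσ : 0 < σ)
    (hp : p ∈ Set.Icc 0 1) (hp0 : 0 < p) (hd : 0 < d) (hα : 2 < α) (hθ : 0 < θ)
    (hA : MeasurableSet A) (hA0 : volume A ≠ 0) (hAtop : volume A ≠ ∞) (q : ℝ) {q' : ℝ}
    (hq' : q' ∈ Set.Icc 0 1) :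
    Tendsto (N.successProbAt A d α θ q q') atTop
      (𝓝 (Real.exp (-(min q' p * lam / lamMax d α θ)))) := by
  have hmax := lamMax_pos hd hα hθ
  have hmin : 0 ≤ min q' p := le_min hq'.1 hp.1
  have hcost : Tendsto (fun t => ENNReal.ofReal lam *
      (N.transmitProb q' t * ENNReal.ofReal (1 / lamMax d α θ))) atTop
      (𝓝 (ENNReal.ofReal (min q' p * lam / lamMax d α θ))) := by
    rw [show min q' p * lam / lamMax d α θ = lam * (min q' p * (1 / lamMax d α θ)) by ring,
      ENNReal.ofReal_mul hlam.le, ENNReal.ofReal_mul hmin]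
    exact ENNReal.Tendsto.const_mul (ENNReal.Tendsto.mul_const (N.tendsto_transmitProb hp hp0 hq')
      (.inr ENNReal.ofReal_ne_top)) (.inr ENNReal.ofReal_ne_top)
  have hlim := (ENNReal.tendsto_toReal (negExp_ne_top _)).comp
    ((continuous_negExp.tendsto _).comp hcost)
  rw [negExp_ofReal (by positivity), ENNReal.toReal_ofReal (Real.exp_pos _).le] at hlim
  exact hlim.congr fun t => (N.typicalProb_eq hlam hA hA0 hAtop
    (N.tsum_measure_inter_setOf_lt_sir hσ hp hd hα hθ hA q hq' t)).symm

lemma throughput_eq [IsProbabilityMeasure P] (hlam : 0 < lam) (hσ : 0 < σ)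
    (hp : p ∈ Set.Icc 0 1) (hp0 : 0 < p) (hd : 0 < d) (hα : 2 < α) (hθ : 0 < θ)
    (hA : MeasurableSet A) (hA0 : volume A ≠ 0) (hAtop : volume A ≠ ∞) (R : ℝ) {q' : ℝ}
    (hq : q ∈ Set.Icc 0 1) (hq' : q' ∈ Set.Icc 0 1) :
    N.throughput A d α θ R q q' =
      min q p * Real.exp (-(min q' p * lam / lamMax d α θ)) * R := by
  have hrate : (if q ≤ p then 1 else p / q) * q = min q p := by
    split_ifs with hqp
    · rw [min_eq_left hqp, one_mul]
    · have hpq := not_le.1 hqp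
      rw [min_eq_right hpq.le, div_mul_cancel₀ _ (hp0.trans hpq).ne']
  rw [throughput, energyProb, successProb,
    (N.tendsto_energyProbAt hlam hp hp0 hA hA0 hAtop hq).limUnder_eq,
    (N.tendsto_successProbAt hlam hσ hp hp0 hd hα hθ hA hA0 hAtop q hq').limUnder_eq, hrate]

end HarvestingNetwork

theorem theorem3 {Ω : Type*} [MeasurableSpace Ω] (P : Measure Ω) [IsProbabilityMeasure P]
    (lam p σ d α θ R : ℝ) (hlam : 0 < lam) (hp : 0 < p) (hp1 : p ≤ 1) (hσ : 0 < σ) (hd : 0 < d)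
    (hα : 2 < α) (hθ : 0 < θ) (hR : 0 < R) (N : HarvestingNetwork P lam p σ)
    (A : Set Plane) (hA : MeasurableSet A) (hA0 : volume A ≠ 0) (hAtop : volume A ≠ ∞) :
    -- the steady-state quantities in the throughput exist
    (∀ q ∈ Set.Icc (0 : ℝ) 1,
      Tendsto (N.energyProbAt A q) atTop (𝓝 (N.energyProb A q))) ∧
    (∀ q ∈ Set.Icc (0 : ℝ) 1, ∀ q' ∈ Set.Icc (0 : ℝ) 1,
      Tendsto (N.successProbAt A d α θ q q') atTop (𝓝 (N.successProb A d α θ q q'))) ∧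
    -- every `qs` between `p` and `1` is a symmetric Nash equilibrium
    (∀ qs : ℝ, p ≤ qs → qs ≤ 1 → N.IsSNE A d α θ R qs) ∧
    -- throughput and transmission capacity at any symmetric Nash equilibrium
    (∀ qs : ℝ, N.IsSNE A d α θ R qs →
      N.throughput A d α θ R qs qs = p * Real.exp (-(p * lam / lamMax d α θ)) * R ∧
      N.capacity A d α θ R qs = lam * p * Real.exp (-(p * lam / lamMax d α θ)) * R) := by
  have hpI : p ∈ Set.Icc (0 : ℝ) 1 := ⟨hp.le, hp1⟩
  have hTH {q q' : ℝ} (hq : q ∈ Set.Icc 0 1) (hq' : q' ∈ Set.Icc 0 1) :=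
    N.throughput_eq hlam hσ hpI hp hd hα hθ hA hA0 hAtop R hq hq'
  refine ⟨fun q hq => ?energy, fun q _ q' hq' => ?success, fun qs hqs hqs1 => ?equilibrium,
    fun qs ⟨hqs, hbest⟩ => ?value⟩
  case energy => exact tendsto_nhds_limUnder ⟨_, N.tendsto_energyProbAt hlam hpI hp hA hA0 hAtop hq⟩
  case success =>
    exact tendsto_nhds_limUnder
      ⟨_, N.tendsto_successProbAt hlam hσ hpI hp hd hα hθ hA hA0 hAtop q hq'⟩
  case equilibrium =>
    have hqsI : qs ∈ Set.Icc (0 : ℝ) 1 := ⟨hp.le.trans hqs, hqs1⟩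
    refine ⟨hqsI, fun q hq => ?_⟩
    rw [hTH hq hqsI, hTH hqsI hqsI, min_eq_right hqs]
    gcongr
    exact min_le_right q p
  case value =>
    have hdev := hbest p hpI
    rw [hTH hpI hqs, hTH hqs hqs, min_self, mul_le_mul_iff_left₀ hR,
      mul_le_mul_iff_left₀ (Real.exp_pos _)] at hdev
    rw [HarvestingNetwork.capacity, hTH hqs hqs, (min_le_right qs p).antisymm hdev]
    exact ⟨rfl, by ring⟩
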